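/- Identify $\mathbb{R}^2$ with $\mathbb{C}$, so that $\mathbf p=p_1+ip_2=re^{i\theta}$. Let $\delta>0$, and put $E(\mathbf p)=\sqrt{|\mathbf p|^2+1}$, $N(\mathbf p)=\sqrt{2E(\mathbf p)(E(\mathbf p)+1)}$, \[ K(\mathbf p,\mathbf p')=\frac{(E(\mathbf p)+1)(E(\mathbf p')+1)+\mathbf p\,\overline{\mathbf p'}}{N(\mathbf p)N(\mathbf p')|\mathbf p-\mathbf p'|}, \] \[ \langle u,\mathbf b u\rangle=\int_{\mathbb R^2} E(\mathbf p)|u(\mathbf p)|^2\,d\mathbf p-\frac{\delta}{2\pi}\int_{\mathbb R^2}\int_{\mathbb R^2} u(\mathbf p)\overline{u(\mathbf p')}K(\mathbf p,\mathbf p')\,d\mathbf p\,d\mathbf p' . \] For $r,r'>0$ let $e(r)=\sqrt{r^2+1}$, $n(r)=\sqrt{2e(r)(e(r)+1)}$, \[ \beta_1(r,r')=\frac{(e(r)+1)(e(r')+1)}{n(r)n(r')},\qquad \beta_2(r,r')=\frac{rr'}{n(r)n(r')},\qquad z(r,r')=\frac12\left(\frac r{r'}+\frac{r'}r\right). \]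 For $k\in\mathbb Z$ let \[ K_k(r,r')=\begin{cases}\beta_1(r,r')\,Q_{k-1/2}(z(r,r'))+\beta_2(r,r')\,Q_{k+1/2}(z(r,r')), & k\ge 0,\\ \beta_1(r,r')\,Q_{-k-1/2}(z(r,r'))+\beta_2(r,r')\,Q_{-k-3/2}(z(r,r')), & k<0,\end{cases} \] where, for $z>1$ and $\nu>-1$, \[ Q_\nu(z)=\frac{\sqrt\pi\,\Gamma(\nu+1)}{\Gamma(\nu+\frac32)(2z)^{\nu+1}}\;{}_2F_1\!\left(\tfrac\nu2+1,\tfrac\nu2+\tfrac12;\nu+\tfrac32;\tfrac1{z^2}\right) \] is the Legendre function of the second kind, and let \[ \langle a,b_k a\rangle=\int_0^\infty e(r)|a(r)|^2\,dr-\frac\delta\pi\int_0^\infty\!\int_0^\infty a(r)\overline{a(r')}K_k(r,r')\,dr\,dr'. \] **Theorem.** Let $u\in L^2\big(\mathbb R^2,\sqrt{1+|\mathbf p|^2}\,d\mathbf p\big)$. Then $u$ has an expansion \[ u(re^{i\theta})=\frac1{\sqrt{2\pi}}\sum_{k\in\mathbb Z}\frac1{\sqrt r}\,a_k(r)e^{ik\theta},\qquad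 a_k\in L^2((0,\infty)), \] converging unconditionally in $L^2(\mathbb R^2)$, and for every such expansion \[ \langle u,\mathbf b u\rangle=\sum_{k\in\mathbb Z}\langle a_k,b_k a_k\rangle . \] All the integrals in $\langle u,\mathbf b u\rangle$ and in $\langle a_k,b_ka_k\rangle$ converge absolutely, and so does the sum over $k$. -/

import Mathlib

open MeasureTheory Set Filter Topology

noncomputable section

namespace BrownRavenhall

/-- Legendre function of the second kind `Q_ν(z)`, for real `z > 1` and `ν > -1`, by its standard
hypergeometric formula
`√π Γ(ν+1) / (Γ(ν+3/2) (2z)^(ν+1)) · F(ν/2 + 1, ν/2 + 1/2; ν + 3/2; 1/z²)`. -/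
def legendreQ (ν z : ℝ) : ℝ :=
  Real.sqrt Real.pi * Real.Gamma (ν + 1) / (Real.Gamma (ν + 3 / 2) * (2 * z) ^ (ν + 1))
    * ordinaryHypergeometric (ν / 2 + 1) (ν / 2 + 1 / 2) (ν + 3 / 2) (1 / z ^ 2)

/-! Momenta `p` in the plane are complex numbers `p₁ + i p₂`. -/

/-- `E(p) = √(|p|² + 1)`. -/
def energy (p : ℂ) : ℝ := Real.sqrt (‖p‖ ^ 2 + 1)

/-- `N(p) = √(2 E(p) (E(p) + 1))`. -/
def normFactor (p : ℂ) : ℝ := Real.sqrt (2 * energy p * (energy p + 1))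

/-- `K(p, p') = ((E(p) + 1)(E(p') + 1) + p * conj p') / (N(p) N(p') |p - p'|)`. -/
def kernel (p p' : ℂ) : ℂ :=
  (((energy p + 1) * (energy p' + 1) : ℝ) + p * starRingEnd ℂ p')
    / ((normFactor p * normFactor p' * ‖p - p'‖ : ℝ) : ℂ)

/-- The integrand `u(p) conj(u(p')) K(p, p')` of the potential term. -/
def potIntegrand (u : ℂ → ℂ) (p p' : ℂ) : ℂ :=
  u p * starRingEnd ℂ (u p') * kernel p p'

/-- The quadratic form `⟨u, b u⟩` of the Brown-Ravenhall operator with coupling `δ`. -/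
def form (δ : ℝ) (u : ℂ → ℂ) : ℂ :=
  ((∫ p, energy p * ‖u p‖ ^ 2 : ℝ) : ℂ)
    - ((δ / (2 * Real.pi) : ℝ) : ℂ) * ∫ p, ∫ p', potIntegrand u p p'

/-- The measure `√(1 + |p|²) dp` on the plane. -/
def weightedMeasure : Measure ℂ :=
  (volume : Measure ℂ).withDensity fun p => ENNReal.ofReal (Real.sqrt (1 + ‖p‖ ^ 2))

/-- `e(r) = √(r² + 1)`. -/
def e (r : ℝ) : ℝ := Real.sqrt (r ^ 2 + 1)

/-- `n(r) = √(2 e(r) (e(r) + 1))`. -/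
def n (r : ℝ) : ℝ := Real.sqrt (2 * e r * (e r + 1))

def β₁ (r r' : ℝ) : ℝ := (e r + 1) * (e r' + 1) / (n r * n r')

def β₂ (r r' : ℝ) : ℝ := r * r' / (n r * n r')

/-- The argument `(r/r' + r'/r) / 2` of the Legendre functions. -/
def legendreArg (r r' : ℝ) : ℝ := 1 / 2 * (r / r' + r' / r)

/-- The partial wave kernel `K_k(r, r')`. -/
def radialKernel (k : ℤ) (r r' : ℝ) : ℝ :=
  if 0 ≤ k then
    β₁ r r' * legendreQ (k - 1 / 2) (legendreArg r r')
      + β₂ r r' * legendreQ (k + 1 / 2) (legendreArg r r')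
  else
    β₁ r r' * legendreQ (-k - 1 / 2) (legendreArg r r')
      + β₂ r r' * legendreQ (-k - 3 / 2) (legendreArg r r')

/-- The integrand `a(r) conj(a(r')) K_k(r, r')` of the potential term of `b_k`. -/
def radialPotIntegrand (k : ℤ) (a : ℝ → ℂ) (r r' : ℝ) : ℂ :=
  a r * starRingEnd ℂ (a r') * (radialKernel k r r' : ℂ)

/-- The one-dimensional form `⟨a, b_k a⟩`. -/
def radialForm (δ : ℝ) (k : ℤ) (a : ℝ → ℂ) : ℂ :=
  ((∫ r in Ioi (0 : ℝ), e r * ‖a r‖ ^ 2 : ℝ) : ℂ)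
    - ((δ / Real.pi : ℝ) : ℂ)
      * ∫ r in Ioi (0 : ℝ), ∫ r' in Ioi (0 : ℝ), radialPotIntegrand k a r r'

/-- The summand `(2π)^(-1/2) r^(-1/2) a_k(r) exp(i k θ)` at the point `p = r exp(i θ)`. -/
def partialWave (a : ℤ → ℝ → ℂ) (k : ℤ) (p : ℂ) : ℂ :=
  ((1 / Real.sqrt (2 * Real.pi) : ℝ) : ℂ) * ((1 / Real.sqrt ‖p‖ : ℝ) : ℂ) * a k ‖p‖
    * Complex.exp (Complex.I * k * Complex.arg p)

/-- `u(r exp(i θ)) = (2π)^(-1/2) ∑_k r^(-1/2) a_k(r) exp(i k θ)` with `a_k` in `L²((0, ∞))`, the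
series converging (unconditionally) to `u` in `L²` of the plane. -/
def IsPartialWaveExpansion (u : ℂ → ℂ) (a : ℤ → ℝ → ℂ) : Prop :=
  (∀ k, MemLp (a k) 2 (volume.restrict (Ioi (0 : ℝ)))) ∧
    Tendsto (fun s : Finset ℤ =>
      eLpNorm (fun p : ℂ => u p - ∑ k ∈ s, partialWave a k p) 2 volume) atTop (𝓝 0)

end BrownRavenhall

end

/-! In polar coordinates |p - p'|² = r r' (2z - 2 cos(θ - θ')), and p conj(p') = r r' e^{i(θ - θ')}.
So for fixed radii the kernel depends only on θ - θ', and the angular Fourier basis diagonalises it.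
Everything reduces to the Fourier series of (2z - 2 cos t)^{-1/2}, whose k-th coefficient is
Q_{|k|-1/2}(z)/π (`hasSum_legendreAbs`). To see this, expand (1 - x)^{-1/2} at x = w e^{it} + w
e^{-it}, w = 1/(2z), as an absolutely convergent double series over monomials e^{iat} e^{-ibt}.
Summing it along a + b = n gives the function, and along a - b = k it gives the hypergeometric
series of Q. The factor e^{i(θ - θ')} multiplying β₂ shifts the index by one, which is why two
neighbouring Legendre functions occur in `radialKernel`.

The analytic input is a Schur test for |p - p'|^{-1} on the plane
(`lintegral_prod_inv_norm_sub_le`). Together with |K| ≤ 2/|p - p'| it bounds the absolute potential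
energy by a constant times the kinetic energy (`lintegral_potIntegrand_le`).

No separate estimate of the one-dimensional forms is needed. Each partial wave is itself a function
on the plane, and its angularly integrated potential energy is exactly the k-th radial density
(`radialDensity_ae_eq`). The planar bound therefore applies to every k with the same constant. By
Parseval the kinetic energies of the partial waves add up to that of u, so the radial densities are
absolutely summable in L¹ and sum and integral may be exchanged (`hasSum_integral_radialDensity`).
Parseval on circles also gives existence and a.e. uniqueness of the expansion, so it suffices to
treat the canonical coefficients `radialPart u`. -/

noncomputable section

namespace BrownRavenhall

open scoped ENNReal

/-! ### Fourier series of (2z - 2 cos t)^{-1/2} and Legendre functions of half-integer degree -/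

section

lemma hasSum_one_div_sqrt_one_sub {x : ℝ} (hx : |x| < 1) :
    HasSum (fun n : ℕ => (ascPochhammer ℝ n).eval (1 / 2) / n.factorial * x ^ n)
      (1 / Real.sqrt (1 - x)) := by
  have h := (Real.one_div_one_sub_rpow_hasFPowerSeriesOnBall_zero (1 / 2)).hasSum (y := x)
    (by simpa [enorm_eq_nnnorm, ← NNReal.coe_lt_coe] using! hx)
  rw [zero_add, ← Real.sqrt_eq_rpow] at h
  convert! h using 2 with n
  rw [FormalMultilinearSeries.ofScalars_apply_eq, smul_eq_mul]
  congr 1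
  have h1 := Ring.factorial_nsmul_multichoose_eq_ascPochhammer (1 / 2 : ℝ) n
  rw [Polynomial.ascPochhammer_smeval_eq_eval] at h1
  rw [← h1, Ring.choose]
  have : (n.factorial : ℝ) ≠ 0 := by positivity
  rw [nsmul_eq_mul, mul_div_cancel_left₀ _ this]
  congr 1
  ring

lemma ascPochhammer_eval_add (x : ℝ) (m n : ℕ) :
    (ascPochhammer ℝ (m + n)).eval x
      = (ascPochhammer ℝ m).eval x * (ascPochhammer ℝ n).eval (x + m) := by
  rw [← ascPochhammer_mul, Polynomial.eval_mul, Polynomial.eval_comp]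
  simp

/-- The even and odd factors of (x)_{2m} separate. This merges the two upper parameters of the
hypergeometric series, which differ by 1/2, into one Pochhammer symbol. -/
lemma ascPochhammer_eval_two_mul (x : ℝ) (m : ℕ) :
    (ascPochhammer ℝ (2 * m)).eval x
      = 4 ^ m * (ascPochhammer ℝ m).eval (x / 2) * (ascPochhammer ℝ m).eval ((x + 1) / 2) := by
  induction m with
  | zero => simp
  | succ m ih =>
    rw [show 2 * (m + 1) = 2 * m + 1 + 1 by ring, ascPochhammer_succ_eval,
      ascPochhammer_succ_eval, ih, ascPochhammer_succ_eval, ascPochhammer_succ_eval]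
    push_cast
    ring

lemma Gamma_nat_add_half_eq (k : ℕ) :
    Real.Gamma (k + 1 / 2) = Real.sqrt Real.pi * (ascPochhammer ℝ k).eval (1 / 2) := by
  induction k with
  | zero => simp [Real.Gamma_one_half_eq, -one_div]
  | succ k ih =>
    rw [ascPochhammer_succ_eval, ← mul_assoc, ← ih]
    push_cast
    rw [show (k : ℝ) + 1 + 1 / 2 = (k + 1 / 2) + 1 by ring, Real.Gamma_add_one (by positivity)]
    ring

lemma factorial_mul_ascPochhammer (k m : ℕ) :
    (k.factorial : ℝ) * (ascPochhammer ℝ m).eval (k + 1 : ℝ) = ((m + k).factorial : ℝ) := by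
  induction m with
  | zero => simp
  | succ m ih =>
    rw [ascPochhammer_succ_eval, ← mul_assoc, ih, show m + 1 + k = (m + k) + 1 by ring,
      Nat.factorial_succ]
    push_cast
    ring

/-- The coefficient of `e^{i(a-b)t}` produced by the monomial `e^{iat} e^{-ibt}` in the expansion
of `(1 - 2 w cos t)^{-1/2}`. -/
def cosCoeff (w : ℝ) (a b : ℕ) : ℝ :=
  (ascPochhammer ℝ (a + b)).eval (1 / 2) / (a.factorial * b.factorial) * w ^ (a + b)

lemma cosCoeff_comm (w : ℝ) (a b : ℕ) : cosCoeff w a b = cosCoeff w b a := by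
  simp only [cosCoeff, add_comm a b, mul_comm (a.factorial : ℝ)]

lemma cosCoeff_nonneg {w : ℝ} (hw : 0 ≤ w) (a b : ℕ) : 0 ≤ cosCoeff w a b := by
  have : 0 < (ascPochhammer ℝ (a + b)).eval (1 / 2 : ℝ) :=
    ascPochhammer_pos _ _ (by norm_num)
  unfold cosCoeff
  positivity

/-- At ν = k - 1/2 the prefactor contributes (1/2)_k / k!, and duplication turns the two upper
symbols into 4^{-m} (k + 1/2)_{2m}. The m-th term then collapses to (1/2)_{k+2m} / (m! (m+k)!) times
(2z)^{-(k+2m)}. -/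
lemma legendreQ_nat_sub_half (k : ℕ) {z : ℝ} (hz : 0 < z) :
    legendreQ (k - 1 / 2) z
      = Real.pi / Real.sqrt (2 * z) * ∑' m : ℕ, cosCoeff (1 / (2 * z)) (m + k) m := by
  rw [legendreQ, ordinaryHypergeometric_eq_tsum]
  simp only [smul_eq_mul]
  rw [show (k : ℝ) - 1 / 2 + 1 = k + 1 / 2 by ring, Gamma_nat_add_half_eq,
    show (k : ℝ) - 1 / 2 + 3 / 2 = k + 1 by ring, Real.Gamma_nat_eq_factorial,
    Real.rpow_add (by positivity), ← Real.sqrt_eq_rpow, Real.rpow_natCast,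
    ← tsum_mul_left, ← tsum_mul_left]
  refine tsum_congr fun m => ?_
  have hp : Real.sqrt Real.pi * Real.sqrt Real.pi = Real.pi := Real.mul_self_sqrt Real.pi_pos.le
  have hs : Real.sqrt (2 * z) ≠ 0 := by positivity
  rw [cosCoeff, show m + k + m = k + 2 * m by ring, ascPochhammer_eval_add,
    ascPochhammer_eval_two_mul, ← factorial_mul_ascPochhammer]
  have h1 : (ascPochhammer ℝ m).eval (k + 1 : ℝ) ≠ 0 :=
    (ascPochhammer_pos _ _ (by positivity)).ne'
  rw [show ((k : ℝ) - 1 / 2) / 2 + 1 = (1 / 2 + k + 1) / 2 by ring,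
    show ((k : ℝ) - 1 / 2) / 2 + 1 / 2 = (1 / 2 + k) / 2 by ring, pow_add, pow_mul]
  have h4 : (4 : ℝ) ^ m * ((1 / (2 * z)) ^ 2) ^ m = (1 / z ^ 2) ^ m := by
    rw [← mul_pow]; congr 1; field_simp; norm_num
  rw [← h4, one_div_pow (2 * z) k]
  generalize Real.sqrt Real.pi = y at hp ⊢
  rw [← hp]
  field_simp

/-- `(a, b) ↦ (a - b, min a b)`. -/
def natPairEquiv : ℕ × ℕ ≃ ℤ × ℕ where
  toFun p := ((p.1 : ℤ) - p.2, min p.1 p.2)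
  invFun q := (q.2 + q.1.toNat, q.2 + (-q.1).toNat)
  left_inv p := by ext <;> (simp; omega)
  right_inv q := by ext <;> simp; omega

/-- By the binomial theorem the nonnegative terms with a + b = n add up to the n-th term of the
series of (1 - x)^{-1/2} at x = 2w. -/
lemma summable_cosCoeff {w : ℝ} (hw : 0 ≤ w) (hw' : 2 * w < 1) :
    Summable fun p : ℕ × ℕ => cosCoeff w p.1 p.2 := by
  rw [← Finset.HasAntidiagonal.sigmaAntidiagonalEquivProd.summable_iff,
    summable_sigma_of_nonneg
      (f := (fun p : ℕ × ℕ => cosCoeff w p.1 p.2) ∘ _) (fun x => cosCoeff_nonneg hw _ _)]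
  refine ⟨fun n => (hasSum_fintype _).summable, ?_⟩
  refine (hasSum_one_div_sqrt_one_sub (x := 2 * w) (by rwa [abs_of_nonneg (by linarith)])).summable.congr
    fun n => ?_
  rw [tsum_fintype]
  simp only [Function.comp, Finset.HasAntidiagonal.sigmaAntidiagonalEquivProd_apply]
  rw [Finset.sum_coe_sort (Finset.HasAntidiagonal.antidiagonal n)
    (fun p : ℕ × ℕ => cosCoeff w p.1 p.2), show 2 * w = w + w by ring,
    (Commute.all w w).add_pow', Finset.mul_sum]
  refine Finset.sum_congr rfl fun p hp => ?_
  obtain rfl := Finset.HasAntidiagonal.mem_antidiagonal.1 hp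
  rw [cosCoeff, nsmul_eq_mul, ← pow_add, Nat.cast_add_choose]
  have : ((p.1 + p.2).factorial : ℝ) ≠ 0 := by positivity
  field_simp

/-- Antidiagonal summation again, now with phases: 2w cos t = w e^{it} + w e^{-it}, and the binomial
theorem expands its n-th power. Absolute summability later allows the same family to be summed along
a - b = k instead. -/
lemma hasSum_cosCoeff {w : ℝ} (hw : 0 ≤ w) (hw' : 2 * w < 1) (t : ℝ) :
    HasSum (fun p : ℕ × ℕ => (cosCoeff w p.1 p.2 : ℂ)
        * Complex.exp (Complex.I * ((p.1 - p.2 : ℤ) : ℂ) * t))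
      ((1 / Real.sqrt (1 - 2 * w * Real.cos t) : ℝ) : ℂ) := by
  have hs : Summable (fun p : ℕ × ℕ => (cosCoeff w p.1 p.2 : ℂ)
        * Complex.exp (Complex.I * ((p.1 - p.2 : ℤ) : ℂ) * t)) := by
    refine Summable.of_norm_bounded (summable_cosCoeff hw hw') fun p => ?_
    rw [norm_mul, Complex.norm_real, Real.norm_of_nonneg (cosCoeff_nonneg hw _ _),
      show Complex.I * ((p.1 - p.2 : ℤ) : ℂ) * t = ((((p.1 - p.2 : ℤ) : ℝ) * t : ℝ) : ℂ) * Complex.I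
        by push_cast; ring, Complex.norm_exp_ofReal_mul_I, mul_one]
  have hx : |2 * w * Real.cos t| < 1 := by
    rw [abs_mul, abs_of_nonneg (by linarith : 0 ≤ 2 * w)]
    nlinarith [Real.abs_cos_le_one t, abs_nonneg (Real.cos t)]
  have h1 := Complex.hasSum_ofReal.2 (hasSum_one_div_sqrt_one_sub hx)
  have h2 := hs.hasSum
  rw [← Finset.HasAntidiagonal.sigmaAntidiagonalEquivProd.hasSum_iff] at h2
  have h3 := h2.sigma (g := fun n : ℕ => (((ascPochhammer ℝ n).eval (1 / 2) / n.factorial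
    * (2 * w * Real.cos t) ^ n : ℝ) : ℂ)) fun n => ?_
  · rw [h1.unique h3]; exact hs.hasSum
  convert hasSum_fintype _ using 1
  simp only [Function.comp, Finset.HasAntidiagonal.sigmaAntidiagonalEquivProd_apply]
  rw [Finset.sum_coe_sort (Finset.HasAntidiagonal.antidiagonal n)
    (fun p : ℕ × ℕ => (cosCoeff w p.1 p.2 : ℂ)
        * Complex.exp (Complex.I * ((p.1 - p.2 : ℤ) : ℂ) * t))]
  have hc : ((2 * w * Real.cos t : ℝ) : ℂ)
      = w * Complex.exp (Complex.I * t) + w * Complex.exp (-(Complex.I * t)) := by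
    push_cast
    rw [Complex.cos]
    ring_nf
  rw [Complex.ofReal_mul, Complex.ofReal_pow, hc, (Commute.all _ _).add_pow', Finset.mul_sum]
  refine Finset.sum_congr rfl fun p hp => ?_
  obtain rfl := Finset.HasAntidiagonal.mem_antidiagonal.1 hp
  rw [cosCoeff, nsmul_eq_mul, Nat.cast_add_choose, mul_pow, mul_pow, ← Complex.exp_nat_mul,
    ← Complex.exp_nat_mul]
  have he : Complex.exp (Complex.I * ((p.1 - p.2 : ℤ) : ℂ) * t)
      = Complex.exp (p.1 * (Complex.I * t)) * Complex.exp (p.2 * -(Complex.I * t)) := by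
    rw [← Complex.exp_add]; congr 1; push_cast; ring
  have : ((p.1 + p.2).factorial : ℂ) ≠ 0 := by exact_mod_cast (Nat.factorial_pos _).ne'
  rw [he]
  push_cast
  rw [pow_add]
  field_simp

/-- `Q_{|k|-1/2}(z)`. -/
def legendreAbs (k : ℤ) (z : ℝ) : ℝ := legendreQ (k.natAbs - 1 / 2) z

lemma legendreAbs_neg (k : ℤ) (z : ℝ) : legendreAbs (-k) z = legendreAbs k z := by
  simp [legendreAbs]

lemma cosCoeff_natPairEquiv_symm (w : ℝ) (k : ℤ) (m : ℕ) :
    cosCoeff w (natPairEquiv.symm (k, m)).1 (natPairEquiv.symm (k, m)).2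
      = cosCoeff w (m + k.natAbs) m := by
  rcases le_total 0 k with h | h
  · have h1 : (-k).toNat = 0 := by omega
    have h2 : k.toNat = k.natAbs := by omega
    simp [natPairEquiv, h1, h2]
  · have h1 : k.toNat = 0 := by omega
    have h2 : (-k).toNat = k.natAbs := by omega
    simp [natPairEquiv, h1, h2, cosCoeff_comm w m]

variable {z : ℝ}

/-- The condition 2w < 1 for w = 1/(2z) is exactly z > 1, so the double series converges and its
restriction to a - b = k is the series for Q_{|k|-1/2}. -/
lemma hasSum_cosCoeff_diag (hz : 1 < z) (k : ℤ) :
    HasSum (fun m : ℕ => cosCoeff (1 / (2 * z)) (m + k.natAbs) m)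
      (Real.sqrt (2 * z) / Real.pi * legendreAbs k z) := by
  have hs := summable_cosCoeff (w := 1 / (2 * z)) (by positivity)
    (by rw [mul_one_div, div_lt_one (by positivity)]; linarith)
  have h := ((natPairEquiv.symm.summable_iff (f := fun p : ℕ × ℕ => cosCoeff (1 / (2 * z)) p.1 p.2)).2
    hs).prod_factor k
  simp only [Function.comp, cosCoeff_natPairEquiv_symm] at h
  convert! h.hasSum using 1
  have : Real.sqrt (2 * z) ≠ 0 := by positivity
  rw [show legendreAbs k z = legendreQ (k.natAbs - 1 / 2) z from rfl,
    legendreQ_nat_sub_half _ (by linarith)]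
  field_simp

lemma legendreAbs_nonneg (hz : 1 < z) (k : ℤ) : 0 ≤ legendreAbs k z := by
  have h := (hasSum_cosCoeff_diag hz k).nonneg fun m => cosCoeff_nonneg (by positivity) _ _
  have : 0 < Real.sqrt (2 * z) / Real.pi := by positivity
  exact nonneg_of_mul_nonneg_right h this

lemma summable_legendreAbs (hz : 1 < z) : Summable fun k : ℤ => legendreAbs k z := by
  have hs := summable_cosCoeff (w := 1 / (2 * z)) (by positivity)
    (by rw [mul_one_div, div_lt_one (by positivity)]; linarith)
  have h := ((natPairEquiv.symm.hasSum_iff (f := fun p : ℕ × ℕ => cosCoeff (1 / (2 * z)) p.1 p.2)).2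
    hs.hasSum).prod_fiberwise (g := fun k => Real.sqrt (2 * z) / Real.pi * legendreAbs k z)
      fun k => by
        simp only [Function.comp, cosCoeff_natPairEquiv_symm]
        exact hasSum_cosCoeff_diag hz k
  have h0 : Real.sqrt (2 * z) / Real.pi ≠ 0 := by positivity
  exact (summable_mul_left_iff h0).1 h.summable

/-- The Fourier expansion of `t ↦ (2 z - 2 cos t)^{-1/2}`. -/
lemma hasSum_legendreAbs (hz : 1 < z) (t : ℝ) :
    HasSum (fun k : ℤ => ((legendreAbs k z / Real.pi : ℝ) : ℂ) * Complex.exp (Complex.I * k * t))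
      ((1 / Real.sqrt (2 * z - 2 * Real.cos t) : ℝ) : ℂ) := by
  have h := ((natPairEquiv.symm.hasSum_iff).2 (hasSum_cosCoeff (w := 1 / (2 * z)) (by positivity)
    (by rw [mul_one_div, div_lt_one (by positivity)]; linarith) t)).prod_fiberwise
      (g := fun k => ((Real.sqrt (2 * z) / Real.pi * legendreAbs k z : ℝ) : ℂ)
        * Complex.exp (Complex.I * k * t)) fun k => by
        have h1 : ∀ m, ((natPairEquiv.symm (k, m)).1 : ℤ) - (natPairEquiv.symm (k, m)).2 = k :=
          fun m => congrArg Prod.fst (natPairEquiv.apply_symm_apply (k, m))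
        simp only [Function.comp, cosCoeff_natPairEquiv_symm, h1]
        exact (Complex.hasSum_ofReal.2 (hasSum_cosCoeff_diag hz k)).mul_right _
  have h0 : Real.sqrt (2 * z) ≠ 0 := by positivity
  convert! h.mul_left (((Real.sqrt (2 * z))⁻¹ : ℝ) : ℂ) using 1
  · funext k
    rw [← mul_assoc, ← Complex.ofReal_mul]
    congr 2
    field_simp
  · rw [← Complex.ofReal_mul]
    congr 1
    rw [show 2 * z - 2 * Real.cos t = 2 * z * (1 - 2 * (1 / (2 * z)) * Real.cos t) by
      field_simp, Real.sqrt_mul (by positivity)]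
    field_simp

end

/-! ### Schur test for the Coulomb kernel on the plane, and the kernel bound -/

section

/-- A radial profile on the plane which is integrable at the origin and at infinity. -/
def rieszProfile (x : ℝ) : ℝ := if x ≤ 1 / 2 then x ^ (-3 / 2 : ℝ) else x ^ (-5 / 2 : ℝ)

lemma integrable_rieszProfile_norm : Integrable fun s : ℂ => rieszProfile ‖s‖ := by
  rw [integrable_fun_norm_addHaar volume (f := rieszProfile), Complex.finrank_real_complex,
    ← Ioc_union_Ioi_eq_Ioi (show (0 : ℝ) ≤ 1 / 2 by norm_num)]
  refine IntegrableOn.union ?_ ?_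
  · have h : IntegrableOn (fun x : ℝ => x ^ (-1 / 2 : ℝ)) (Ioc 0 (1 / 2)) := by
      rw [integrableOn_Ioc_iff_integrableOn_Ioo]
      exact (intervalIntegral.integrableOn_Ioo_rpow_iff (by norm_num)).2 (by norm_num)
    refine h.congr_fun (fun x hx => ?_) measurableSet_Ioc
    simp only [rieszProfile, if_pos hx.2, smul_eq_mul]
    rw [← Real.rpow_natCast, ← Real.rpow_add hx.1]
    norm_num
  · have h := integrableOn_Ioi_rpow_of_lt (show (-3 / 2 : ℝ) < -1 by norm_num)
      (show (0 : ℝ) < 1 / 2 by norm_num)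
    refine h.congr_fun (fun x hx => ?_) measurableSet_Ioi
    have hx' : (1 / 2 : ℝ) < x := hx
    simp only [rieszProfile, if_neg (not_le.2 hx'), smul_eq_mul]
    rw [← Real.rpow_natCast, ← Real.rpow_add (by linarith)]
    norm_num

/-- Meant for x = |s| and y = |1 - s|. If one of them is at most 1/2, the other is at least 1/2 and
its factor is bounded. If both exceed 1/2, the product is at most t^{-5/2} for the smaller one, t.
-/
lemma rpow_mul_inv_le_rieszProfile {x y : ℝ} (hx : 0 ≤ x) (hy : 0 ≤ y) (hxy : 1 ≤ x + y) :
    x ^ (-3 / 2 : ℝ) * y⁻¹ ≤ 4 * (rieszProfile x + rieszProfile y) := by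
  have hnn : ∀ {t : ℝ}, 0 ≤ t → 0 ≤ rieszProfile t := fun {t} ht => by
    unfold rieszProfile; split_ifs <;> positivity
  have h0x := hnn hx
  have h0y := hnn hy
  rcases le_or_gt x (1 / 2) with h | h
  · have hy' : 1 / 2 ≤ y := by linarith
    have h1 : y⁻¹ ≤ 2 := inv_le_of_inv_le₀ (by norm_num) (by linarith)
    have h2 : rieszProfile x = x ^ (-3 / 2 : ℝ) := if_pos h
    have h3 := mul_le_mul_of_nonneg_left h1 (h2 ▸ h0x)
    linarith
  rcases le_or_gt y (1 / 2) with h' | h'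
  · have h1 : x ^ (-3 / 2 : ℝ) ≤ 4 := by
      calc x ^ (-3 / 2 : ℝ) ≤ (1 / 2 : ℝ) ^ (-3 / 2 : ℝ) :=
            Real.rpow_le_rpow_of_nonpos (by norm_num) h.le (by norm_num)
        -- Passing to an integer exponent gives the round constant 4.
        _ ≤ (1 / 2 : ℝ) ^ (-2 : ℝ) :=
            Real.rpow_le_rpow_of_exponent_ge (by norm_num) (by norm_num) (by norm_num)
        _ = 4 := by norm_num [Real.rpow_neg]
    have h2 : y⁻¹ ≤ y ^ (-3 / 2 : ℝ) := by
      rcases hy.eq_or_lt with rfl | hy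
      · simp only [inv_zero]; positivity
      rw [← Real.rpow_neg_one]
      exact Real.rpow_le_rpow_of_exponent_ge hy (by linarith) (by norm_num)
    have h3 : rieszProfile y = y ^ (-3 / 2 : ℝ) := if_pos h'
    have h4 := mul_le_mul h1 h2 (by positivity) (by norm_num)
    linarith
  · have key : ∀ {t : ℝ}, 0 < t → t ^ (-3 / 2 : ℝ) * t⁻¹ = t ^ (-5 / 2 : ℝ) := fun {t} ht => by
      rw [← Real.rpow_neg_one t, ← Real.rpow_add ht]; norm_num
    have hpx : rieszProfile x = x ^ (-5 / 2 : ℝ) := if_neg (not_le.2 h)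
    have hpy : rieszProfile y = y ^ (-5 / 2 : ℝ) := if_neg (not_le.2 h')
    rcases le_total x y with hle | hle
    · have := mul_le_mul_of_nonneg_left (inv_anti₀ (by linarith) hle)
        (show 0 ≤ x ^ (-3 / 2 : ℝ) by positivity)
      rw [key (by linarith), ← hpx] at this
      linarith
    · have := mul_le_mul_of_nonneg_right (Real.rpow_le_rpow_of_nonpos (by linarith) hle
        (show (-3 / 2 : ℝ) ≤ 0 by norm_num)) (show 0 ≤ y⁻¹ by positivity)
      rw [key (by linarith), ← hpy] at this
      linarith

/-- `∫ |s|^{-3/2} |1 - s|^{-1} ds` over the plane. -/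
def rieszConst : ENNReal := ∫⁻ s : ℂ, ENNReal.ofReal (‖s‖ ^ (-3 / 2 : ℝ) * ‖1 - s‖⁻¹)

lemma rieszConst_ne_top : rieszConst ≠ ⊤ := by
  have h1 : Integrable fun s : ℂ => 4 * (rieszProfile ‖s‖ + rieszProfile ‖1 - s‖) :=
    (integrable_rieszProfile_norm.add (integrable_rieszProfile_norm.comp_sub_left 1)).const_mul 4
  refine (lt_of_le_of_lt (lintegral_mono fun s => ENNReal.ofReal_le_ofReal ?_)
    h1.lintegral_lt_top).ne
  refine rpow_mul_inv_le_rieszProfile (norm_nonneg _) (norm_nonneg _) ?_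
  calc (1 : ℝ) = ‖s + (1 - s)‖ := by simp
    _ ≤ _ := norm_add_le _ _

/-- Multiplication by p is a real-linear map of determinant |p|², the norm of p in ℂ/ℝ. -/
lemma lintegral_comp_mul_left {p : ℂ} (hp : p ≠ 0) {g : ℂ → ENNReal} (hg : Measurable g) :
    ∫⁻ q, g q = ENNReal.ofReal (‖p‖ ^ 2) * ∫⁻ s, g (p * s) := by
  have hd : LinearMap.det (Algebra.lmul ℝ ℂ p) = ‖p‖ ^ 2 := by
    rw [← Algebra.norm_apply, Algebra.norm_complex_apply, Complex.normSq_eq_norm_sq]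
  have hp' : 0 < ‖p‖ ^ 2 := by positivity
  have h := Measure.map_linearMap_addHaar_eq_smul_addHaar (volume : Measure ℂ)
    (f := Algebra.lmul ℝ ℂ p) (by rw [hd]; exact hp'.ne')
  have h2 : ∫⁻ s, g (p * s) = ∫⁻ q, g q ∂(Measure.map (Algebra.lmul ℝ ℂ p) volume) :=
    (lintegral_map hg (by change Measurable fun s => p * s; fun_prop)).symm
  rw [h2, h, hd, lintegral_smul_measure, smul_eq_mul, ← mul_assoc,
    ← ENNReal.ofReal_mul hp'.le, abs_of_pos (inv_pos.2 hp'), mul_inv_cancel₀ hp'.ne']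
  simp

/-- Homogeneity: substituting q = p s collects the exponents 2 - 3/2 - 1 = -1/2. -/
lemma lintegral_rpow_mul_inv_norm_sub {p : ℂ} (hp : p ≠ 0) :
    ∫⁻ q : ℂ, ENNReal.ofReal (‖q‖ ^ (-3 / 2 : ℝ) * ‖p - q‖⁻¹)
      = ENNReal.ofReal (‖p‖ ^ (-1 / 2 : ℝ)) * rieszConst := by
  have hp' : 0 < ‖p‖ := by positivity
  rw [lintegral_comp_mul_left hp (by fun_prop), rieszConst, ← lintegral_const_mul _ (by fun_prop),
    ← lintegral_const_mul _ (by fun_prop)]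
  refine lintegral_congr fun s => ?_
  rw [← ENNReal.ofReal_mul (by positivity), ← ENNReal.ofReal_mul (by positivity)]
  congr 1
  rw [show p - p * s = p * (1 - s) by ring, norm_mul, norm_mul, mul_inv,
    Real.mul_rpow (norm_nonneg _) (norm_nonneg _), ← Real.rpow_natCast, ← Real.rpow_neg_one ‖p‖]
  calc _ = (‖p‖ ^ ((2 : ℕ) : ℝ) * ‖p‖ ^ (-3 / 2 : ℝ) * ‖p‖ ^ (-1 : ℝ))
        * (‖s‖ ^ (-3 / 2 : ℝ) * ‖1 - s‖⁻¹) := by ring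
    _ = _ := by
      rw [← Real.rpow_add hp', ← Real.rpow_add hp']
      norm_num

/-- A weighted Young inequality without the factor 1/2, which makes one of the two summands
sufficient: the second if a t ≤ b, the first otherwise. -/
lemma ENNReal_mul_le_sq_mul_add {a b s t : ENNReal} (h : t * s = 1) :
    a * b ≤ a ^ 2 * t + b ^ 2 * s := by
  rcases le_total (a * t) b with h1 | h1
  · refine le_add_left ?_
    calc a * b = (a * t) * s * b := by rw [mul_assoc a, h, mul_one]
      _ ≤ b * s * b := by gcongr
      _ = _ := by ring
  · refine le_add_right ?_
    calc a * b ≤ a * (a * t) := by gcongr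
      _ = _ := by ring

/-- Schur's test for the kernel `|p - q|^{-1}` on the plane. -/
lemma lintegral_prod_inv_norm_sub_le {f : ℂ → ENNReal} (hf : AEMeasurable f) :
    ∫⁻ q : ℂ × ℂ, f q.1 * f q.2 * ENNReal.ofReal (‖q.1 - q.2‖⁻¹) ∂(volume.prod volume)
      ≤ 2 * rieszConst * ∫⁻ p, ENNReal.ofReal ‖p‖ * f p ^ 2 := by
  -- The Schur weight (|p|/|q|)^{3/2}. With exponent 3/2 the integral of |q|^{-3/2} |p - q|^{-1}
  -- converges both at the origin (3/2 < 2) and at infinity (5/2 > 2), and swapping the variables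
  -- inverts the weight.
  set T : ℂ × ℂ → ENNReal := fun q =>
    ENNReal.ofReal (‖q.1‖ ^ (3 / 2 : ℝ)) * ENNReal.ofReal (‖q.2‖ ^ (-3 / 2 : ℝ)) with hT
  set G : ℂ × ℂ → ENNReal := fun q => f q.1 ^ 2 * T q * ENNReal.ofReal (‖q.1 - q.2‖⁻¹) with hG
  have hTm : Measurable T := by fun_prop
  have hf1 : AEMeasurable (fun q : ℂ × ℂ => f q.1) (volume.prod volume) := hf.comp_fst
  have hGm : AEMeasurable G (volume.prod volume) := by
    refine ((hf1.pow_const 2).mul hTm.aemeasurable).mul (Measurable.aemeasurable ?_)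
    fun_prop
  have hne : ∀ᵐ p : ℂ, p ≠ 0 := by simp [ae_iff]
  have hne1 : ∀ᵐ q : ℂ × ℂ ∂(volume.prod volume), q.1 ≠ 0 :=
    Measure.quasiMeasurePreserving_fst.ae hne
  have hne2 : ∀ᵐ q : ℂ × ℂ ∂(volume.prod volume), q.2 ≠ 0 :=
    Measure.quasiMeasurePreserving_snd.ae hne
  have hGi : ∫⁻ q, G q ∂(volume.prod volume)
      = rieszConst * ∫⁻ p, ENNReal.ofReal ‖p‖ * f p ^ 2 := by
    rw [lintegral_prod _ hGm, ← lintegral_const_mul'' _ (by fun_prop)]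
    refine lintegral_congr_ae (hne.mono fun p hp => ?_)
    have hp' : 0 < ‖p‖ := by positivity
    calc ∫⁻ q, G (p, q) = ∫⁻ q : ℂ, f p ^ 2 * ENNReal.ofReal (‖p‖ ^ (3 / 2 : ℝ))
          * ENNReal.ofReal (‖q‖ ^ (-3 / 2 : ℝ) * ‖p - q‖⁻¹) := by
            refine lintegral_congr fun q => ?_
            rw [ENNReal.ofReal_mul (by positivity)]
            simp only [hG, hT]
            ring
      _ = _ := by
            rw [lintegral_const_mul _ (by fun_prop), lintegral_rpow_mul_inv_norm_sub hp]
            have : ENNReal.ofReal ‖p‖ = ENNReal.ofReal (‖p‖ ^ (3 / 2 : ℝ))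
                * ENNReal.ofReal (‖p‖ ^ (-1 / 2 : ℝ)) := by
              rw [← ENNReal.ofReal_mul (by positivity), ← Real.rpow_add hp']
              norm_num
            beta_reduce
            rw [this]
            ring
  calc _ ≤ ∫⁻ q, (G q + G q.swap) ∂(volume.prod volume) := by
        refine lintegral_mono_ae ?_
        filter_upwards [hne1, hne2] with q h1 h2
        have hts : T q * T q.swap = 1 := by
          have h1' : 0 < ‖q.1‖ := by positivity
          have h2' : 0 < ‖q.2‖ := by positivity
          simp only [hT, Prod.fst_swap, Prod.snd_swap]
          rw [← ENNReal.ofReal_mul (by positivity), ← ENNReal.ofReal_mul (by positivity),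
            ← ENNReal.ofReal_mul (by positivity)]
          rw [show ‖q.1‖ ^ (3 / 2 : ℝ) * ‖q.2‖ ^ (-3 / 2 : ℝ)
            * (‖q.2‖ ^ (3 / 2 : ℝ) * ‖q.1‖ ^ (-3 / 2 : ℝ))
            = (‖q.1‖ ^ (3 / 2 : ℝ) * ‖q.1‖ ^ (-3 / 2 : ℝ))
            * (‖q.2‖ ^ (3 / 2 : ℝ) * ‖q.2‖ ^ (-3 / 2 : ℝ)) by ring,
            ← Real.rpow_add h1', ← Real.rpow_add h2']
          norm_num
        simp only [hG, Prod.fst_swap, Prod.snd_swap, norm_sub_rev q.2 q.1]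
        rw [← add_mul]
        gcongr
        exact ENNReal_mul_le_sq_mul_add hts
    _ = 2 * ∫⁻ q, G q ∂(volume.prod volume) := by
        rw [lintegral_add_left' hGm, lintegral_prod_swap, two_mul]
    _ = _ := by rw [hGi, mul_assoc]

lemma one_le_energy (p : ℂ) : 1 ≤ energy p :=
  Real.one_le_sqrt.2 (by linarith [sq_nonneg ‖p‖])

lemma norm_le_energy (p : ℂ) : ‖p‖ ≤ energy p :=
  Real.le_sqrt_of_sq_le (by linarith)

lemma energy_add_one_le_normFactor (p : ℂ) : energy p + 1 ≤ normFactor p :=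
  Real.le_sqrt_of_sq_le (by nlinarith [one_le_energy p])

/-- Since N ≥ E + 1 ≥ |p|, each of the two terms in the numerator is at most N(p) N(p'). At p = p'
both sides are 0 by the convention for division by zero. -/
lemma norm_kernel_le (p p' : ℂ) : ‖kernel p p'‖ ≤ 2 * ‖p - p'‖⁻¹ := by
  have h1 := one_le_energy p
  have h2 := one_le_energy p'
  have h3 := energy_add_one_le_normFactor p
  have h4 := energy_add_one_le_normFactor p'
  have h5 : (energy p + 1) * (energy p' + 1) ≤ normFactor p * normFactor p' := by gcongr; linarith
  have h6 : ‖p‖ * ‖p'‖ ≤ normFactor p * normFactor p' := by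
    gcongr
    · linarith
    · linarith [norm_le_energy p]
    · linarith [norm_le_energy p']
  have h7 : 0 < normFactor p * normFactor p' := mul_pos (by linarith) (by linarith)
  rw [kernel, norm_div, Complex.norm_real, Real.norm_of_nonneg (by positivity), mul_comm
    (normFactor p * normFactor p'), ← div_div, div_eq_mul_inv, div_eq_mul_inv, mul_right_comm]
  gcongr
  rw [← div_eq_mul_inv, div_le_iff₀ h7]
  refine (norm_add_le _ _).trans ?_
  rw [Complex.norm_real, Real.norm_of_nonneg (by positivity), norm_mul, RCLike.norm_conj]
  linarith

@[fun_prop]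
lemma measurable_energy : Measurable energy := by unfold energy; fun_prop

@[fun_prop]
lemma measurable_normFactor : Measurable normFactor := by unfold normFactor; fun_prop

@[fun_prop]
lemma measurable_kernel : Measurable fun q : ℂ × ℂ => kernel q.1 q.2 := by
  unfold kernel
  have : Measurable fun q : ℂ × ℂ => starRingEnd ℂ q.2 :=
    Complex.continuous_conj.measurable.comp measurable_snd
  fun_prop

end

/-! ### Polar coordinates and Fourier coefficients on circles -/

section

/-- The measure `dr` on `(0, ∞)`. -/
def halfLine : Measure ℝ := volume.restrict (Ioi 0)

/-- The measure `r dr` on `(0, ∞)`. -/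
def radialMeasure : Measure ℝ := halfLine.withDensity ENNReal.ofReal

/-- The measure `dθ` on `(-π, π)`. -/
def angleMeasure : Measure ℝ := volume.restrict (Ioo (-Real.pi) Real.pi)

instance : SigmaFinite halfLine := by unfold halfLine; infer_instance

instance : SigmaFinite radialMeasure := by
  unfold radialMeasure
  exact SigmaFinite.withDensity_of_ne_top (Eventually.of_forall fun _ => ENNReal.ofReal_ne_top)

instance : IsFiniteMeasure angleMeasure :=
  ⟨by simp [angleMeasure, ENNReal.ofReal_lt_top]⟩

/-- `(r, θ) ↦ r e^{iθ}`. -/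
def polarMap (q : ℝ × ℝ) : ℂ := q.1 * Complex.exp (Complex.I * q.2)

@[fun_prop]
lemma measurable_polarMap : Measurable polarMap := by unfold polarMap; fun_prop

lemma ae_halfLine_pos : ∀ᵐ r ∂halfLine, 0 < r := ae_restrict_mem measurableSet_Ioi

lemma radialMeasure_ac : radialMeasure ≪ halfLine := withDensity_absolutelyContinuous _ _

lemma halfLine_ac : halfLine ≪ radialMeasure :=
  withDensity_absolutelyContinuous' (by fun_prop) (ae_halfLine_pos.mono fun r hr => by simpa)

lemma ae_radialMeasure_pos : ∀ᵐ r ∂radialMeasure, 0 < r :=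
  radialMeasure_ac.ae_le ae_halfLine_pos

lemma ae_angleMeasure_mem : ∀ᵐ θ ∂angleMeasure, θ ∈ Ioo (-Real.pi) Real.pi :=
  ae_restrict_mem measurableSet_Ioo

lemma lintegral_radialMeasure (f : ℝ → ℝ≥0∞) :
    ∫⁻ r, f r ∂radialMeasure = ∫⁻ r, ENNReal.ofReal r * f r ∂halfLine := by
  rw [radialMeasure, lintegral_withDensity_eq_lintegral_mul_non_measurable _ (by fun_prop)
    (by simp)]
  rfl

/-- Stating polar coordinates as a measure-preserving map from a product measure makes Fubini and
the transfer of measurability and integrability directly available. -/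
lemma measurePreserving_polarMap :
    MeasurePreserving polarMap (radialMeasure.prod angleMeasure) volume := by
  refine ⟨measurable_polarMap, Measure.ext_of_lintegral _ fun f hf => ?_⟩
  rw [lintegral_map hf measurable_polarMap, radialMeasure, prod_withDensity_left (by fun_prop),
    halfLine, angleMeasure, Measure.prod_restrict,
    lintegral_withDensity_eq_lintegral_mul_non_measurable _ (by fun_prop) (by simp),
    ← Complex.lintegral_comp_polarCoord_symm f]
  change _ = ∫⁻ q in Ioi 0 ×ˢ Ioo (-Real.pi) Real.pi,
    ENNReal.ofReal q.1 • f (Complex.polarCoord.symm q)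
  refine lintegral_congr fun q => ?_
  simp only [Pi.mul_apply, smul_eq_mul, Complex.polarCoord_symm_apply, polarMap]
  rw [mul_comm Complex.I, Complex.exp_mul_I, Complex.ofReal_cos, Complex.ofReal_sin]

lemma norm_polarMap {r : ℝ} (hr : 0 < r) (θ : ℝ) : ‖polarMap (r, θ)‖ = r := by
  simp only [polarMap]
  rw [norm_mul, mul_comm Complex.I, Complex.norm_exp_ofReal_mul_I, mul_one, Complex.norm_real,
    Real.norm_of_nonneg hr.le]

lemma arg_polarMap {r : ℝ} (hr : 0 < r) {θ : ℝ} (hθ : θ ∈ Ioo (-Real.pi) Real.pi) :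
    Complex.arg (polarMap (r, θ)) = θ := by
  simp only [polarMap]
  rw [mul_comm Complex.I, Complex.exp_mul_I]
  exact Complex.arg_mul_cos_add_sin_mul_I hr ⟨hθ.1, hθ.2.le⟩

/-- The Fourier coefficient `(2π)^{-1/2} ∫ f(θ) e^{-ikθ} dθ`. -/
def angleCoeff (f : ℝ → ℂ) (k : ℤ) : ℂ :=
  ((1 / Real.sqrt (2 * Real.pi) : ℝ) : ℂ)
    * ∫ θ, f θ * Complex.exp (-(Complex.I * k * θ)) ∂angleMeasure

lemma norm_exp_I_mul (k : ℤ) (θ : ℝ) : ‖Complex.exp (Complex.I * k * θ)‖ = 1 := by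
  rw [show Complex.I * k * θ = (((k : ℝ) * θ : ℝ) : ℂ) * Complex.I by push_cast; ring,
    Complex.norm_exp_ofReal_mul_I]

lemma norm_exp_neg_I_mul (k : ℤ) (θ : ℝ) : ‖Complex.exp (-(Complex.I * k * θ))‖ = 1 := by
  rw [Complex.exp_neg, norm_inv, norm_exp_I_mul, inv_one]

lemma integral_angleMeasure (f : ℝ → ℂ) :
    ∫ θ, f θ ∂angleMeasure = ∫ θ in (-Real.pi)..Real.pi, f θ := by
  rw [angleMeasure, ← integral_Ioc_eq_integral_Ioo,
    intervalIntegral.integral_of_le (by linarith [Real.pi_pos])]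

lemma integral_exp_angle (k : ℤ) :
    ∫ θ : ℝ, Complex.exp (Complex.I * k * θ) ∂angleMeasure
      = if k = 0 then 2 * (Real.pi : ℂ) else 0 := by
  rw [integral_angleMeasure]
  split_ifs with h
  · subst h
    simp
    ring
  · have hc : Complex.I * (k : ℂ) ≠ 0 := mul_ne_zero Complex.I_ne_zero (by exact_mod_cast h)
    rw [integral_exp_mul_complex hc]
    have : Complex.exp (Complex.I * k * Real.pi) = Complex.exp (Complex.I * k * (-Real.pi : ℝ)) := by
      rw [Complex.exp_eq_exp_iff_exists_int]
      exact ⟨k, by push_cast; ring⟩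
    rw [this, sub_self, zero_div]

lemma angleCoeff_eq_fourierCoeffOn (f : ℝ → ℂ) (k : ℤ) :
    angleCoeff f k = ((Real.sqrt (2 * Real.pi) : ℝ) : ℂ)
      * fourierCoeffOn (show -Real.pi < Real.pi by linarith [Real.pi_pos]) f k := by
  have hs : Real.sqrt (2 * Real.pi) * Real.sqrt (2 * Real.pi) = 2 * Real.pi :=
    Real.mul_self_sqrt (by positivity)
  have hs0 : Real.sqrt (2 * Real.pi) ≠ 0 := by positivity
  rw [fourierCoeffOn_eq_integral, angleCoeff, integral_angleMeasure, Complex.real_smul, ← mul_assoc,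
    ← Complex.ofReal_mul]
  congr 1
  · congr 1
    rw [show Real.pi - -Real.pi = 2 * Real.pi by ring]
    generalize Real.sqrt (2 * Real.pi) = y at hs hs0
    rw [← hs]
    field_simp
  · refine intervalIntegral.integral_congr fun θ _ => ?_
    simp only [fourier_coe_apply, smul_eq_mul]
    rw [mul_comm]
    congr 2
    have : (Real.pi : ℂ) ≠ 0 := by exact_mod_cast Real.pi_ne_zero
    push_cast
    rw [show (Real.pi : ℂ) - -Real.pi = 2 * Real.pi by ring]
    field_simp

/-- Parseval. The factor (2π)^{-1/2} in `angleCoeff` is the normalisation that makes the constant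
equal to 1. -/
lemma tsum_enorm_angleCoeff_sq {f : ℝ → ℂ} (hf : MemLp f 2 angleMeasure) :
    ∑' k, ‖angleCoeff f k‖ₑ ^ 2 = ∫⁻ θ, ‖f θ‖ₑ ^ 2 ∂angleMeasure := by
  have hlt : -Real.pi < Real.pi := by linarith [Real.pi_pos]
  have h := hasSum_sq_fourierCoeffOn (f := f) hlt (by
    rwa [restrict_Ioo_eq_restrict_Ioc.symm])
  have h2 := h.mul_left (2 * Real.pi)
  rw [intervalIntegral.integral_of_le hlt.le, integral_Ioc_eq_integral_Ioo,
    show Real.pi - -Real.pi = 2 * Real.pi by ring, smul_eq_mul, ← mul_assoc,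
    mul_inv_cancel₀ (by positivity), one_mul] at h2
  have hi : Integrable (fun θ => ‖f θ‖ ^ 2) angleMeasure :=
    (memLp_two_iff_integrable_sq_norm hf.1).1 hf
  have h3 := ofReal_integral_eq_lintegral_ofReal hi (Eventually.of_forall fun _ => by positivity)
  simp only [ENNReal.ofReal_pow (norm_nonneg _), ofReal_norm] at h3
  rw [← h3, angleMeasure, ← h2.tsum_eq, ENNReal.ofReal_tsum_of_nonneg (fun k => by positivity)
    h2.summable]
  refine tsum_congr fun k => ?_
  rw [← ofReal_norm, ← ENNReal.ofReal_pow (norm_nonneg _), angleCoeff_eq_fourierCoeffOn, norm_mul,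
    mul_pow, Complex.norm_real, Real.norm_of_nonneg (by positivity), Real.sq_sqrt (by positivity)]

lemma integrable_mul_exp {f : ℝ → ℂ} (hf : Integrable f angleMeasure) (k : ℤ) :
    Integrable (fun θ : ℝ => f θ * Complex.exp (-(Complex.I * k * θ))) angleMeasure :=
  hf.mul_bdd (c := 1) (by fun_prop) (Eventually.of_forall fun θ => (norm_exp_neg_I_mul k θ).le)

lemma angleCoeff_sub {f g : ℝ → ℂ} (hf : Integrable f angleMeasure)
    (hg : Integrable g angleMeasure) (k : ℤ) :
    angleCoeff (fun θ => f θ - g θ) k = angleCoeff f k - angleCoeff g k := by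
  simp only [angleCoeff, sub_mul]
  rw [integral_sub (integrable_mul_exp hf k) (integrable_mul_exp hg k), mul_sub]

lemma angleCoeff_congr {f g : ℝ → ℂ} (h : f =ᵐ[angleMeasure] g) (k : ℤ) :
    angleCoeff f k = angleCoeff g k := by
  unfold angleCoeff
  rw [integral_congr_ae (h.mono fun θ hθ => by rw [hθ])]

lemma angleCoeff_exp (c : ℂ) (j k : ℤ) :
    angleCoeff (fun θ => c * Complex.exp (Complex.I * j * θ)) k
      = if j = k then Real.sqrt (2 * Real.pi) * c else 0 := by
  have h : ∀ θ : ℝ, c * Complex.exp (Complex.I * j * θ) * Complex.exp (-(Complex.I * k * θ))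
      = c * Complex.exp (Complex.I * ((j - k : ℤ) : ℂ) * θ) := fun θ => by
    rw [mul_assoc, ← Complex.exp_add]
    congr 2
    push_cast
    ring
  simp only [angleCoeff, h, integral_const_mul, integral_exp_angle, sub_eq_zero]
  split_ifs with hjk
  · have hs : Real.sqrt (2 * Real.pi) * Real.sqrt (2 * Real.pi) = 2 * Real.pi :=
      Real.mul_self_sqrt (by positivity)
    have hs0 : (Real.sqrt (2 * Real.pi) : ℂ) ≠ 0 := by
      exact_mod_cast (by positivity : Real.sqrt (2 * Real.pi) ≠ 0)
    have hs' : (2 * Real.pi : ℂ) = Real.sqrt (2 * Real.pi) * Real.sqrt (2 * Real.pi) := by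
      exact_mod_cast hs.symm
    rw [hs']
    push_cast
    field_simp
  · simp

/-- The Fourier coefficient of `u` on the circle of radius `r`. -/
def circleCoeff (u : ℂ → ℂ) (k : ℤ) (r : ℝ) : ℂ := angleCoeff (fun θ => u (polarMap (r, θ))) k

variable {u : ℂ → ℂ}

lemma aestronglyMeasurable_comp_polarMap (hu : AEStronglyMeasurable u volume) :
    AEStronglyMeasurable (fun q => u (polarMap q)) (radialMeasure.prod angleMeasure) :=
  hu.comp_quasiMeasurePreserving measurePreserving_polarMap.quasiMeasurePreserving

lemma aestronglyMeasurable_circleCoeff (hu : AEStronglyMeasurable u volume) (k : ℤ) :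
    AEStronglyMeasurable (circleCoeff u k) radialMeasure := by
  unfold circleCoeff angleCoeff
  refine AEStronglyMeasurable.const_mul ?_ _
  refine AEStronglyMeasurable.integral_prod_right'
    (f := fun q : ℝ × ℝ => u (polarMap q) * Complex.exp (-(Complex.I * k * q.2))) ?_
  refine (aestronglyMeasurable_comp_polarMap hu).mul ?_
  exact Measurable.aestronglyMeasurable (by fun_prop)

lemma lintegral_polar {f : ℂ → ℝ≥0∞} (hf : AEMeasurable f) :
    ∫⁻ p, f p = ∫⁻ r, ∫⁻ θ, f (polarMap (r, θ)) ∂angleMeasure ∂radialMeasure := by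
  have hf' : AEMeasurable (fun q => f (polarMap q)) (radialMeasure.prod angleMeasure) :=
    hf.comp_quasiMeasurePreserving measurePreserving_polarMap.quasiMeasurePreserving
  rw [← lintegral_prod _ hf', ← measurePreserving_polarMap.map_eq]
  refine lintegral_map' ?_ (by fun_prop)
  rwa [measurePreserving_polarMap.map_eq]

lemma ae_memLp_circle (hu : MemLp u 2 volume) :
    ∀ᵐ r ∂radialMeasure, MemLp (fun θ => u (polarMap (r, θ))) 2 angleMeasure := by
  have h2 : ∫⁻ p, ‖u p‖ₑ ^ 2 < ⊤ := by
    have := hu.integrable_norm_pow (by norm_num : (2 : ℕ) ≠ 0)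
    simpa [hasFiniteIntegral_iff_enorm] using! this.2
  rw [lintegral_polar (hu.1.enorm.pow_const 2)] at h2
  have hm := aestronglyMeasurable_comp_polarMap hu.1
  have h3 := ae_lt_top' ((hm.enorm.pow_const 2).lintegral_prod_right') h2.ne
  filter_upwards [hm.prodMk_left, h3] with r h4 h5
  rw [memLp_two_iff_integrable_sq_norm h4]
  refine ⟨(h4.norm.pow 2), ?_⟩
  simpa [hasFiniteIntegral_iff_enorm] using! h5

/-- Parseval's identity on circles, integrated against a radial weight. -/
lemma tsum_lintegral_circleCoeff (hu : MemLp u 2 volume) {g : ℝ → ℝ≥0∞} (hg : Measurable g) :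
    ∑' k, ∫⁻ r, g r * ‖circleCoeff u k r‖ₑ ^ 2 ∂radialMeasure
      = ∫⁻ p, g ‖p‖ * ‖u p‖ₑ ^ 2 := by
  rw [← lintegral_tsum (f := fun k r => g r * ‖circleCoeff u k r‖ₑ ^ 2)
    fun k => hg.aemeasurable.mul ((aestronglyMeasurable_circleCoeff hu.1 k).enorm.pow_const 2),
    lintegral_polar (f := fun p => g ‖p‖ * ‖u p‖ₑ ^ 2)
    ((hg.comp measurable_norm).aemeasurable.mul (hu.1.enorm.pow_const 2))]
  refine lintegral_congr_ae ?_
  filter_upwards [ae_memLp_circle hu, ae_radialMeasure_pos] with r h1 h2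
  simp only [ENNReal.tsum_mul_left, norm_polarMap h2]
  rw [lintegral_const_mul'' _ (h1.1.enorm.pow_const 2), ← tsum_enorm_angleCoeff_sq h1]
  rfl

/-- A null set of radii gives a union of circles of zero area. This is what makes a_k(|p|) a.e.
strongly measurable when a_k is only so. -/
lemma quasiMeasurePreserving_norm :
    Measure.QuasiMeasurePreserving (fun p : ℂ => ‖p‖) volume halfLine := by
  refine ⟨by fun_prop, Measure.AbsolutelyContinuous.mk fun s hs h0 => ?_⟩
  rw [Measure.map_apply measurable_norm hs, ← lintegral_indicator_one (measurable_norm hs),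
    lintegral_polar (by exact (measurable_one.indicator (measurable_norm hs)).aemeasurable)]
  have h1 : ∀ᵐ r ∂radialMeasure, r ∉ s := radialMeasure_ac.ae_le (measure_eq_zero_iff_ae_notMem.1 h0)
  rw [lintegral_eq_zero_iff' (by
    refine (Measurable.lintegral_prod_right' (ν := angleMeasure)
      (f := fun q => ((fun p : ℂ => ‖p‖) ⁻¹' s).indicator 1 (polarMap q)) ?_).aemeasurable
    exact (measurable_one.indicator (measurable_norm hs)).comp measurable_polarMap)]
  filter_upwards [h1, ae_radialMeasure_pos] with r h2 h3
  simp [norm_polarMap h3, indicator, h2]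

/-! ### Partial waves: isometry, existence and uniqueness of the expansion -/

variable {a : ℤ → ℝ → ℂ}

lemma aestronglyMeasurable_partialWave {k : ℤ} (ha : AEStronglyMeasurable (a k) halfLine) :
    AEStronglyMeasurable (partialWave a k) volume := by
  unfold partialWave
  have h := ha.comp_quasiMeasurePreserving quasiMeasurePreserving_norm
  refine (AEStronglyMeasurable.mul ?_ h).mul ?_
  · exact Measurable.aestronglyMeasurable (by fun_prop)
  · exact Measurable.aestronglyMeasurable (by fun_prop)

lemma partialWave_polarMap {r : ℝ} (hr : 0 < r) {θ : ℝ} (hθ : θ ∈ Ioo (-Real.pi) Real.pi)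
    (k : ℤ) :
    partialWave a k (polarMap (r, θ))
      = ((1 / Real.sqrt (2 * Real.pi) : ℝ) : ℂ) * ((1 / Real.sqrt r : ℝ) : ℂ) * a k r
        * Complex.exp (Complex.I * k * θ) := by
  rw [partialWave, norm_polarMap hr, arg_polarMap hr hθ]

lemma norm_partialWave (k : ℤ) (p : ℂ) :
    ‖partialWave a k p‖ = 1 / Real.sqrt (2 * Real.pi) * (1 / Real.sqrt ‖p‖) * ‖a k ‖p‖‖ := by
  rw [partialWave, norm_mul, norm_mul, norm_mul, norm_exp_I_mul, mul_one, Complex.norm_real,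
    Complex.norm_real, Real.norm_of_nonneg (by positivity), Real.norm_of_nonneg (by positivity)]

/-- The squared prefactor 1/(2π r) cancels the angular mass 2π and the Jacobian r. -/
lemma lintegral_partialWave_sq {k : ℤ} (ha : AEStronglyMeasurable (a k) halfLine)
    {g : ℝ → ℝ≥0∞} (hg : Measurable g) :
    ∫⁻ p, g ‖p‖ * ‖partialWave a k p‖ₑ ^ 2 = ∫⁻ r, g r * ‖a k r‖ₑ ^ 2 ∂halfLine := by
  rw [lintegral_polar (f := fun p => g ‖p‖ * ‖partialWave a k p‖ₑ ^ 2)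
    ((hg.comp measurable_norm).aemeasurable.mul
    ((aestronglyMeasurable_partialWave ha).enorm.pow_const 2)), lintegral_radialMeasure]
  refine lintegral_congr_ae ?_
  filter_upwards [ae_halfLine_pos] with r hr
  have h1 : ∀ θ, ‖partialWave a k (polarMap (r, θ))‖ₑ ^ 2
      = ENNReal.ofReal (1 / (2 * Real.pi) * (1 / r)) * ‖a k r‖ₑ ^ 2 := fun θ => by
    rw [← ofReal_norm, ← ofReal_norm, ← ENNReal.ofReal_pow (norm_nonneg _),
      ← ENNReal.ofReal_pow (norm_nonneg _), ← ENNReal.ofReal_mul (by positivity), norm_partialWave,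
      norm_polarMap hr, mul_pow, mul_pow, div_pow, div_pow, Real.sq_sqrt (by positivity),
      Real.sq_sqrt hr.le, one_pow]
  simp only [norm_polarMap hr, h1, lintegral_const]
  have h2 : angleMeasure univ = ENNReal.ofReal (2 * Real.pi) := by
    rw [angleMeasure, Measure.restrict_apply_univ, Real.volume_Ioo]
    ring_nf
  rw [h2]
  have h3 : ENNReal.ofReal r * (ENNReal.ofReal (1 / (2 * Real.pi) * (1 / r))
      * ENNReal.ofReal (2 * Real.pi)) = 1 := by
    rw [← ENNReal.ofReal_mul (by positivity), ← ENNReal.ofReal_mul (by positivity),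
      ← ENNReal.ofReal_one]
    congr 1
    field_simp
  calc _ = ENNReal.ofReal r * (ENNReal.ofReal (1 / (2 * Real.pi) * (1 / r))
      * ENNReal.ofReal (2 * Real.pi)) * (g r * ‖a k r‖ₑ ^ 2) := by ring
    _ = _ := by rw [h3, one_mul]

lemma eLpNorm_two_sq {α : Type*} [MeasurableSpace α] (μ : Measure α) (f : α → ℂ) :
    eLpNorm f 2 μ ^ 2 = ∫⁻ x, ‖f x‖ₑ ^ 2 ∂μ := by
  have := eLpNorm_nnreal_pow_eq_lintegral (μ := μ) (f := f) (p := 2) (by norm_num)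
  simpa only [NNReal.coe_ofNat, ENNReal.rpow_ofNat, ENNReal.coe_ofNat] using this

lemma memLp_two_of_lintegral {α : Type*} [MeasurableSpace α] {μ : Measure α} {f : α → ℂ}
    (hf : AEStronglyMeasurable f μ) (h : ∫⁻ x, ‖f x‖ₑ ^ 2 ∂μ ≠ ⊤) : MemLp f 2 μ := by
  refine ⟨hf, ?_⟩
  rw [← eLpNorm_two_sq] at h
  rw [lt_top_iff_ne_top]
  rintro h'
  simp [h'] at h

lemma memLp_partialWave {k : ℤ} (ha : MemLp (a k) 2 halfLine) :
    MemLp (partialWave a k) 2 volume := by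
  refine memLp_two_of_lintegral (aestronglyMeasurable_partialWave ha.1) ?_
  have := lintegral_partialWave_sq ha.1 (g := 1) measurable_one
  simp only [Pi.one_apply, one_mul] at this
  rw [this, ← eLpNorm_two_sq]
  exact ENNReal.pow_ne_top ha.2.ne

/-- Orthogonality of the exponentials on almost every circle: only the k-th wave contributes to the
k-th coefficient. -/
lemma circleCoeff_sub_sum (hu : MemLp u 2 volume) (s : Finset ℤ) (k : ℤ) :
    ∀ᵐ r ∂radialMeasure, circleCoeff (fun p => u p - ∑ j ∈ s, partialWave a j p) k r
      = circleCoeff u k r - if k ∈ s then ((1 / Real.sqrt r : ℝ) : ℂ) * a k r else 0 := by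
  filter_upwards [ae_memLp_circle hu, ae_radialMeasure_pos] with r h1 hr
  set c : ℤ → ℂ := fun j =>
    ((1 / Real.sqrt (2 * Real.pi) : ℝ) : ℂ) * ((1 / Real.sqrt r : ℝ) : ℂ) * a j r with hc
  have hi : ∀ j, Integrable (fun θ : ℝ => c j * Complex.exp (Complex.I * j * θ)) angleMeasure :=
    fun j => Integrable.of_bound (C := ‖c j‖) (by fun_prop) (Eventually.of_forall fun θ => by
      rw [norm_mul, norm_exp_I_mul, mul_one])
  have h2 : (fun θ => u (polarMap (r, θ)) - ∑ j ∈ s, partialWave a j (polarMap (r, θ)))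
      =ᵐ[angleMeasure] fun θ => u (polarMap (r, θ))
        - ∑ j ∈ s, c j * Complex.exp (Complex.I * j * θ) := by
    filter_upwards [ae_angleMeasure_mem] with θ hθ
    simp only [partialWave_polarMap hr hθ, hc]
  have hsum : angleCoeff (fun θ : ℝ => ∑ j ∈ s, c j * Complex.exp (Complex.I * j * θ)) k
      = ∑ j ∈ s, angleCoeff (fun θ : ℝ => c j * Complex.exp (Complex.I * j * θ)) k := by
    simp only [angleCoeff, Finset.sum_mul]
    rw [integral_finsetSum _ fun j _ => integrable_mul_exp (hi j) k, Finset.mul_sum]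
  rw [circleCoeff, angleCoeff_congr h2, angleCoeff_sub (h1.integrable (by norm_num))
    (integrable_finsetSum _ fun j _ => hi j), hsum]
  simp only [angleCoeff_exp, Finset.sum_ite_eq']
  rw [circleCoeff]
  congr 1
  split_ifs
  · have hs0 : (Real.sqrt (2 * Real.pi) : ℂ) ≠ 0 := by
      exact_mod_cast (by positivity : Real.sqrt (2 * Real.pi) ≠ 0)
    simp only [hc]
    push_cast
    field_simp
  · rfl

lemma eLpNorm_sub_sum_sq (hu : MemLp u 2 volume) (ha : ∀ k, MemLp (a k) 2 halfLine)
    (s : Finset ℤ) :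
    eLpNorm (fun p => u p - ∑ j ∈ s, partialWave a j p) 2 volume ^ 2
      = ∑' k, ∫⁻ r, ‖circleCoeff u k r - if k ∈ s then ((1 / Real.sqrt r : ℝ) : ℂ) * a k r
          else 0‖ₑ ^ 2 ∂radialMeasure := by
  have h1 : MemLp (fun p => u p - ∑ j ∈ s, partialWave a j p) 2 volume :=
    hu.sub (memLp_finsetSum s fun j _ => memLp_partialWave (ha j))
  have h2 := tsum_lintegral_circleCoeff h1 (g := 1) measurable_one
  simp only [Pi.one_apply, one_mul] at h2
  rw [eLpNorm_two_sq, ← h2]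
  refine tsum_congr fun k => lintegral_congr_ae ?_
  filter_upwards [circleCoeff_sub_sum hu s k] with r hr
  rw [hr]

/-- The radial functions `a_k(r) = r^{1/2} û_k(r)` of the partial wave expansion of `u`. -/
def radialPart (u : ℂ → ℂ) (k : ℤ) (r : ℝ) : ℂ := (Real.sqrt r : ℂ) * circleCoeff u k r

lemma aestronglyMeasurable_radialPart (hu : AEStronglyMeasurable u volume) (k : ℤ) :
    AEStronglyMeasurable (radialPart u k) halfLine := by
  refine AEStronglyMeasurable.mul ?_ ((aestronglyMeasurable_circleCoeff hu k).mono_ac halfLine_ac)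
  exact Measurable.aestronglyMeasurable (by fun_prop)

lemma lintegral_radialPart_sq (k : ℤ) (g : ℝ → ℝ≥0∞) :
    ∫⁻ r, g r * ‖radialPart u k r‖ₑ ^ 2 ∂halfLine
      = ∫⁻ r, g r * ‖circleCoeff u k r‖ₑ ^ 2 ∂radialMeasure := by
  rw [lintegral_radialMeasure]
  refine lintegral_congr_ae (ae_halfLine_pos.mono fun r hr => ?_)
  have : ‖(Real.sqrt r : ℂ)‖ₑ ^ 2 = ENNReal.ofReal r := by
    rw [← ofReal_norm, ← ENNReal.ofReal_pow (norm_nonneg _), Complex.norm_real,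
      Real.norm_of_nonneg (by positivity), Real.sq_sqrt hr.le]
  simp only [radialPart, enorm_mul, mul_pow, this]
  ring

lemma tsum_lintegral_radialPart (hu : MemLp u 2 volume) {g : ℝ → ℝ≥0∞} (hg : Measurable g) :
    ∑' k, ∫⁻ r, g r * ‖radialPart u k r‖ₑ ^ 2 ∂halfLine = ∫⁻ p, g ‖p‖ * ‖u p‖ₑ ^ 2 := by
  simp only [lintegral_radialPart_sq, tsum_lintegral_circleCoeff hu hg]

lemma lintegral_sq_ne_top (hu : MemLp u 2 volume) : ∫⁻ p, ‖u p‖ₑ ^ 2 ≠ ⊤ := by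
  rw [← eLpNorm_two_sq]
  exact ENNReal.pow_ne_top hu.2.ne

lemma memLp_radialPart (hu : MemLp u 2 volume) (k : ℤ) : MemLp (radialPart u k) 2 halfLine := by
  refine memLp_two_of_lintegral (aestronglyMeasurable_radialPart hu.1 k) ?_
  have h := tsum_lintegral_radialPart hu (g := 1) measurable_one
  simp only [Pi.one_apply, one_mul] at h
  exact ne_top_of_le_ne_top (h ▸ lintegral_sq_ne_top hu) (ENNReal.le_tsum k)

/-- By Parseval the squared error after removing the waves in s is the sum of the coefficient norms
over k ∉ s, a tail of a convergent series. Since s ranges over all finite sets, the convergence is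
unconditional. -/
lemma isPartialWaveExpansion_radialPart (hu : MemLp u 2 volume) :
    IsPartialWaveExpansion u (radialPart u) := by
  refine ⟨memLp_radialPart hu, ?_⟩
  have h := tsum_lintegral_circleCoeff hu (g := 1) measurable_one
  simp only [Pi.one_apply, one_mul] at h
  have ht := ENNReal.tendsto_tsum_compl_atTop_zero (h ▸ lintegral_sq_ne_top hu)
  have hsq : ∀ s : Finset ℤ,
      eLpNorm (fun p => u p - ∑ j ∈ s, partialWave (radialPart u) j p) 2 volume ^ 2
        = ∑' k : {k // k ∉ s}, ∫⁻ r, ‖circleCoeff u k r‖ₑ ^ 2 ∂radialMeasure := fun s => by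
    rw [eLpNorm_sub_sum_sq hu (memLp_radialPart hu)]
    have hs : Function.support (fun k => ∫⁻ r, ‖circleCoeff u k r
        - if k ∈ s then ((1 / Real.sqrt r : ℝ) : ℂ) * radialPart u k r else 0‖ₑ ^ 2 ∂radialMeasure)
        ⊆ {k | k ∉ s} := fun k hk hks => hk <| by
      beta_reduce
      rw [← lintegral_zero (μ := radialMeasure)]
      refine lintegral_congr_ae (ae_radialMeasure_pos.mono fun r hr => ?_)
      have h3 : (Real.sqrt r : ℂ) ≠ 0 := by
        exact_mod_cast (by positivity : Real.sqrt r ≠ 0)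
      simp [if_pos hks, radialPart, h3]
    rw [← tsum_subtype_eq_of_support_subset hs]
    refine tsum_congr fun k => lintegral_congr fun r => ?_
    rw [if_neg k.2, sub_zero]
  simp only [← hsq] at ht
  have := (ENNReal.continuous_rpow_const (y := (1 / 2 : ℝ))).tendsto 0 |>.comp ht
  rw [ENNReal.zero_rpow_of_pos (by norm_num)] at this
  refine this.congr fun s => ?_
  simp only [Function.comp, ← ENNReal.rpow_natCast, ← ENNReal.rpow_mul]
  norm_num

/-- Once s contains k, the k-th Parseval term of the error no longer depends on s; it is bounded by
the full error, which tends to 0, so it vanishes. -/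
lemma IsPartialWaveExpansion.ae_eq_radialPart (hu : MemLp u 2 volume)
    (h : IsPartialWaveExpansion u a) (k : ℤ) : a k =ᵐ[halfLine] radialPart u k := by
  have ht : Tendsto (fun s : Finset ℤ =>
      eLpNorm (fun p => u p - ∑ j ∈ s, partialWave a j p) 2 volume ^ 2) atTop (𝓝 0) := by
    simpa [Function.comp_def] using (ENNReal.continuous_pow 2).tendsto 0 |>.comp h.2
  have h0 : ∫⁻ r, ‖circleCoeff u k r - ((1 / Real.sqrt r : ℝ) : ℂ) * a k r‖ₑ ^ 2 ∂radialMeasure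
      = 0 := by
    refine le_antisymm (ge_of_tendsto ht ?_) zero_le
    filter_upwards [eventually_ge_atTop {k}] with s hs
    have hk : k ∈ s := hs (Finset.mem_singleton_self k)
    rw [eLpNorm_sub_sum_sq hu h.1]
    refine le_trans ?_ (ENNReal.le_tsum k)
    simp only [if_pos hk, le_refl]
  have hm : AEMeasurable (fun r => ‖circleCoeff u k r - ((1 / Real.sqrt r : ℝ) : ℂ) * a k r‖ₑ ^ 2)
      radialMeasure := by
    refine ((aestronglyMeasurable_circleCoeff hu.1 k).sub (AEStronglyMeasurable.mul ?_
      ((h.1 k).1.mono_ac radialMeasure_ac))).enorm.pow_const 2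
    exact Measurable.aestronglyMeasurable (by fun_prop)
  have h1 := halfLine_ac.ae_le ((lintegral_eq_zero_iff' hm).1 h0)
  filter_upwards [h1, ae_halfLine_pos] with r hr hr0
  have h2 : circleCoeff u k r = ((1 / Real.sqrt r : ℝ) : ℂ) * a k r := by
    simpa [sub_eq_zero] using hr
  have h3 : (Real.sqrt r : ℂ) ≠ 0 := by
    exact_mod_cast (by positivity : Real.sqrt r ≠ 0)
  rw [radialPart, h2]
  push_cast
  field_simp

end

/-! ### The kernel in polar coordinates and its angular expansion -/

section

lemma one_lt_legendreArg {r r' : ℝ} (hr : 0 < r) (hr' : 0 < r') (h : r ≠ r') :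
    1 < legendreArg r r' := by
  have h1 : legendreArg r r' - 1 = (r - r') ^ 2 / (2 * r * r') := by
    rw [legendreArg]; field_simp; ring
  have h2 : 0 < (r - r') ^ 2 := by have := sub_ne_zero.2 h; positivity
  have : 0 < (r - r') ^ 2 / (2 * r * r') := by positivity
  linarith

/-- The law of cosines, with r² + r'² written as 2 r r' z. -/
lemma norm_polarMap_sub {r r' : ℝ} (hr : 0 < r) (hr' : 0 < r') (θ θ' : ℝ) :
    ‖polarMap (r, θ) - polarMap (r', θ')‖
      = Real.sqrt (r * r') * Real.sqrt (2 * legendreArg r r' - 2 * Real.cos (θ - θ')) := by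
  rw [← Real.sqrt_mul (by positivity), ← Real.sqrt_sq (norm_nonneg _)]
  congr 1
  rw [← Complex.normSq_eq_norm_sq, Complex.normSq_apply]
  have hre : ∀ s t : ℝ, (polarMap (s, t)).re = s * Real.cos t := fun s t => by
    simp only [polarMap]
    rw [mul_comm Complex.I, Complex.re_ofReal_mul, Complex.exp_ofReal_mul_I_re]
  have him : ∀ s t : ℝ, (polarMap (s, t)).im = s * Real.sin t := fun s t => by
    simp only [polarMap]
    rw [mul_comm Complex.I, Complex.im_ofReal_mul, Complex.exp_ofReal_mul_I_im]
  rw [Complex.sub_re, Complex.sub_im, hre, hre, him, him, Real.cos_sub, legendreArg]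
  have h1 := Real.sin_sq_add_cos_sq θ
  have h2 := Real.sin_sq_add_cos_sq θ'
  have h3 : r * r' * (2 * (1 / 2 * (r / r' + r' / r))) = r ^ 2 + r' ^ 2 := by field_simp
  rw [mul_sub (r * r'), h3]
  linear_combination r ^ 2 * h1 + r' ^ 2 * h2

lemma kernel_polarMap {r r' : ℝ} (hr : 0 < r) (hr' : 0 < r') (θ θ' : ℝ) :
    kernel (polarMap (r, θ)) (polarMap (r', θ'))
      = ((1 / Real.sqrt (r * r') : ℝ) : ℂ)
        * ((β₁ r r' + β₂ r r' * Complex.exp (Complex.I * ((θ - θ' : ℝ) : ℂ)))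
          * ((1 / Real.sqrt (2 * legendreArg r r' - 2 * Real.cos (θ - θ')) : ℝ) : ℂ)) := by
  have he : ∀ {s : ℝ} (_ : 0 < s) t, energy (polarMap (s, t)) = e s := fun hs t => by
    rw [energy, norm_polarMap hs, e]
  have hn : ∀ {s : ℝ} (_ : 0 < s) t, normFactor (polarMap (s, t)) = n s := fun hs t => by
    rw [normFactor, he hs, n]
  have hp : polarMap (r, θ) * starRingEnd ℂ (polarMap (r', θ'))
      = ((r * r' : ℝ) : ℂ) * Complex.exp (Complex.I * ((θ - θ' : ℝ) : ℂ)) := by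
    simp only [polarMap, map_mul, Complex.conj_ofReal, ← Complex.exp_conj, Complex.conj_I]
    rw [show Complex.I * ((θ - θ' : ℝ) : ℂ) = Complex.I * θ + -Complex.I * θ' by push_cast; ring,
      Complex.exp_add]
    push_cast
    ring
  rw [kernel, he hr, he hr', hn hr, hn hr', hp, norm_polarMap_sub hr hr', β₁, β₂]
  push_cast
  simp only [div_eq_mul_inv, mul_inv]
  ring

/-- The two cases of the definition agree once degrees are written as |k| - 1/2 and |k + 1| - 1/2:
for k < 0 these are -k - 1/2 and -k - 3/2. -/
lemma radialKernel_eq (k : ℤ) (r r' : ℝ) :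
    radialKernel k r r' = β₁ r r' * legendreAbs k (legendreArg r r')
      + β₂ r r' * legendreAbs (k + 1) (legendreArg r r') := by
  unfold radialKernel legendreAbs
  split_ifs with h
  · have h1 : ((k.natAbs : ℕ) : ℝ) = k := by
      rw [Nat.cast_natAbs, abs_of_nonneg h]
    have h2 : (((k + 1).natAbs : ℕ) : ℝ) = k + 1 := by
      rw [Nat.cast_natAbs, abs_of_nonneg (by omega)]; push_cast; ring
    rw [h1, h2]
    ring_nf
  · have h1 : ((k.natAbs : ℕ) : ℝ) = -k := by
      rw [Nat.cast_natAbs, abs_of_nonpos (by omega)]; push_cast; ring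
    have h2 : (((k + 1).natAbs : ℕ) : ℝ) = -(k + 1) := by
      rw [Nat.cast_natAbs, abs_of_nonpos (by omega)]; push_cast; ring
    rw [h1, h2]
    ring_nf

lemma β₁_nonneg (r r' : ℝ) : 0 ≤ β₁ r r' := by unfold β₁ e n; positivity

lemma β₂_nonneg {r r' : ℝ} (hr : 0 < r) (hr' : 0 < r') : 0 ≤ β₂ r r' := by
  unfold β₂ n; positivity

section

variable {r r' : ℝ}

lemma radialKernel_nonneg (hr : 0 < r) (hr' : 0 < r') (h : r ≠ r') (k : ℤ) :
    0 ≤ radialKernel k r r' := by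
  have hz := one_lt_legendreArg hr hr' h
  rw [radialKernel_eq]
  exact add_nonneg (mul_nonneg (β₁_nonneg _ _) (legendreAbs_nonneg hz _))
    (mul_nonneg (β₂_nonneg hr hr') (legendreAbs_nonneg hz _))

lemma summable_radialKernel (hr : 0 < r) (hr' : 0 < r') (h : r ≠ r') :
    Summable fun k => radialKernel k r r' := by
  have hz := one_lt_legendreArg hr hr' h
  simp only [radialKernel_eq]
  exact ((summable_legendreAbs hz).mul_left _).add
    (((Equiv.addRight (1 : ℤ)).summable_iff.2 (summable_legendreAbs hz)).mul_left _)

/-- The Fourier expansion of the kernel in the relative angle. -/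
lemma hasSum_kernel_polarMap (hr : 0 < r) (hr' : 0 < r') (h : r ≠ r') (θ θ' : ℝ) :
    HasSum (fun k : ℤ => ((radialKernel k r r' / (Real.pi * Real.sqrt (r * r')) : ℝ) : ℂ)
        * (Complex.exp (-(Complex.I * k * θ)) * Complex.exp (Complex.I * k * θ')))
      (kernel (polarMap (r, θ)) (polarMap (r', θ'))) := by
  have hz := one_lt_legendreArg hr hr' h
  -- Index -k pairs with the phase e^{-ik(θ - θ')}. For the β₂ term index -(k + 1) is used, since
  -- its extra factor e^{i(θ - θ')} raises the frequency back to -k.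
  have h1 := (Equiv.neg ℤ).hasSum_iff.2 (hasSum_legendreAbs hz (θ - θ'))
  have h2 := ((Equiv.addRight (1 : ℤ)).hasSum_iff.2 h1)
  rw [kernel_polarMap hr hr', add_mul]
  have h3 := ((h1.mul_left (β₁ r r' : ℂ)).add (h2.mul_left
    ((β₂ r r' : ℂ) * Complex.exp (Complex.I * ((θ - θ' : ℝ) : ℂ))))).mul_left
      ((1 / Real.sqrt (r * r') : ℝ) : ℂ)
  convert! h3 using 1
  funext k
  have e1 : Complex.exp (-(Complex.I * k * θ)) * Complex.exp (Complex.I * k * θ')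
      = Complex.exp (Complex.I * ((-k : ℤ) : ℂ) * ((θ - θ' : ℝ) : ℂ)) := by
    rw [← Complex.exp_add]
    congr 1
    push_cast
    ring
  have e2 : Complex.exp (Complex.I * ((θ - θ' : ℝ) : ℂ))
      * Complex.exp (Complex.I * ((-(k + 1) : ℤ) : ℂ) * ((θ - θ' : ℝ) : ℂ))
      = Complex.exp (Complex.I * ((-k : ℤ) : ℂ) * ((θ - θ' : ℝ) : ℂ)) := by
    rw [← Complex.exp_add]
    congr 1
    push_cast
    ring
  simp only [Function.comp, Equiv.neg_apply, Equiv.coe_addRight, legendreAbs_neg]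
  rw [e1, radialKernel_eq, mul_comm _ (Complex.exp (Complex.I * ((-(k + 1) : ℤ) : ℂ) * _)),
    mul_assoc (β₂ r r' : ℂ), ← mul_assoc (Complex.exp (Complex.I * ((θ - θ' : ℝ) : ℂ))), e2]
  push_cast
  field_simp

/-- The angular integrals of the kernel against a product function. -/
lemma hasSum_angleCoeff_kernel (hr : 0 < r) (hr' : 0 < r') (h : r ≠ r') {f g : ℝ → ℂ}
    (hf : Integrable f angleMeasure) (hg : Integrable g angleMeasure) :
    HasSum (fun k : ℤ => ((2 * radialKernel k r r' / Real.sqrt (r * r') : ℝ) : ℂ)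
        * (angleCoeff f k * starRingEnd ℂ (angleCoeff g k)))
      (∫ y, f y.1 * starRingEnd ℂ (g y.2) * kernel (polarMap (r, y.1)) (polarMap (r', y.2))
        ∂(angleMeasure.prod angleMeasure)) := by
  set c : ℤ → ℝ := fun k => radialKernel k r r' / (Real.pi * Real.sqrt (r * r')) with hc
  have hc0 : ∀ k, 0 ≤ c k := fun k =>
    div_nonneg (radialKernel_nonneg hr hr' h k) (by positivity)
  have hcs : Summable c := (summable_radialKernel hr hr' h).div_const _
  have hg' : ∀ k : ℤ, Integrable
      (fun θ : ℝ => starRingEnd ℂ (g θ * Complex.exp (-(Complex.I * k * θ)))) angleMeasure :=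
    fun k => (Complex.conjCLE.toContinuousLinearMap.integrable_comp (integrable_mul_exp hg k))
  set F : ℤ → ℝ × ℝ → ℂ := fun k y => (c k : ℂ)
    * ((f y.1 * Complex.exp (-(Complex.I * k * y.1)))
      * starRingEnd ℂ (g y.2 * Complex.exp (-(Complex.I * k * y.2)))) with hF
  have hFi : ∀ k, Integrable (F k) (angleMeasure.prod angleMeasure) := fun k =>
    ((integrable_mul_exp hf k).mul_prod (hg' k)).const_mul _
  have hFn : ∀ k y, ‖F k y‖ = c k * (‖f y.1‖ * ‖g y.2‖) := fun k y => by
    simp only [hF, norm_mul, RCLike.norm_conj, norm_exp_neg_I_mul, mul_one, Complex.norm_real,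
      Real.norm_of_nonneg (hc0 k)]
  -- The phases have modulus 1, so the L¹ norms are the summable nonnegative coefficients c k times
  -- a fixed number; this justifies termwise integration.
  have hs : Summable fun k => ∫ y, ‖F k y‖ ∂(angleMeasure.prod angleMeasure) := by
    simp only [hFn, integral_const_mul]
    exact hcs.mul_right _
  have hmain := hasSum_integral_of_summable_integral_norm hFi hs
  convert! hmain using 1
  · funext k
    simp only [hF, integral_const_mul]
    rw [integral_prod_mul (fun θ : ℝ => f θ * Complex.exp (-(Complex.I * k * θ)))
      (fun θ : ℝ => starRingEnd ℂ (g θ * Complex.exp (-(Complex.I * k * θ)))), integral_conj]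
    simp only [angleCoeff, map_mul, Complex.conj_ofReal, hc]
    have hs : Real.sqrt (2 * Real.pi) * Real.sqrt (2 * Real.pi) = 2 * Real.pi :=
      Real.mul_self_sqrt (by positivity)
    have h2 : (2 * radialKernel k r r' / Real.sqrt (r * r'))
        * ((1 / Real.sqrt (2 * Real.pi)) * (1 / Real.sqrt (2 * Real.pi)))
        = radialKernel k r r' / (Real.pi * Real.sqrt (r * r')) := by
      rw [one_div_mul_one_div, hs]
      field_simp
    rw [← h2]
    push_cast
    ring
  · refine integral_congr_ae (Eventually.of_forall fun y => ?_)
    have h1 := ((hasSum_kernel_polarMap hr hr' h y.1 y.2).mul_left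
      (f y.1 * starRingEnd ℂ (g y.2))).tsum_eq
    beta_reduce
    rw [← h1]
    refine tsum_congr fun k => ?_
    simp only [hF, hc, map_mul, ← Complex.exp_conj, map_neg, Complex.conj_I, Complex.conj_ofReal,
      map_intCast]
    rw [show -(-Complex.I * (k : ℂ) * (y.2 : ℂ)) = Complex.I * k * y.2 by ring]
    ring

end

/-- `((r, r'), (θ, θ')) ↦ (r e^{iθ}, r' e^{iθ'})`. -/
def polarMap₂ (x : (ℝ × ℝ) × (ℝ × ℝ)) : ℂ × ℂ :=
  (polarMap (x.1.1, x.2.1), polarMap (x.1.2, x.2.2))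

lemma measurePreserving_prod_prod_comm {α β : Type*} [MeasurableSpace α] [MeasurableSpace β]
    (μ : Measure α) (ν : Measure β) [SigmaFinite μ] [SigmaFinite ν] :
    MeasurePreserving (fun x : (α × α) × (β × β) => ((x.1.1, x.2.1), (x.1.2, x.2.2)))
      ((μ.prod μ).prod (ν.prod ν)) ((μ.prod ν).prod (μ.prod ν)) := by
  refine ⟨by fun_prop, Measure.ext_of_lintegral _ fun f hf => ?_⟩
  rw [lintegral_map hf (by fun_prop), lintegral_prod _ (by fun_prop), lintegral_prod _ (by fun_prop),
    lintegral_prod _ (by fun_prop), lintegral_prod _ (by fun_prop)]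
  refine lintegral_congr fun a => ?_
  have h1 : ∀ a', ∫⁻ b, f ((a, b.1), (a', b.2)) ∂(ν.prod ν)
      = ∫⁻ b, ∫⁻ b', f ((a, b), (a', b')) ∂ν ∂ν := fun a' => lintegral_prod _ (by fun_prop)
  have h2 : ∀ b, ∫⁻ p, f ((a, b), p) ∂(μ.prod ν)
      = ∫⁻ a', ∫⁻ b', f ((a, b), (a', b')) ∂ν ∂μ := fun a' => lintegral_prod _ (by fun_prop)
  simp only [h1, h2]
  rw [lintegral_lintegral_swap (by fun_prop)]

lemma measurePreserving_polarMap₂ :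
    MeasurePreserving polarMap₂
      ((radialMeasure.prod radialMeasure).prod (angleMeasure.prod angleMeasure))
      (volume.prod volume) :=
  (measurePreserving_polarMap.prod measurePreserving_polarMap).comp
    (measurePreserving_prod_prod_comm radialMeasure angleMeasure)

/-! ### Potential energy: absolute convergence and summation over partial waves -/

variable {u : ℂ → ℂ}

lemma aestronglyMeasurable_potIntegrand (hu : AEStronglyMeasurable u volume) :
    AEStronglyMeasurable (fun q : ℂ × ℂ => potIntegrand u q.1 q.2) (volume.prod volume) := by
  unfold potIntegrand
  refine (hu.comp_fst.mul ?_).mul measurable_kernel.aestronglyMeasurable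
  exact Complex.continuous_conj.comp_aestronglyMeasurable hu.comp_snd

/-- The kinetic energy `∫ E |u|²`. -/
def kinetic (u : ℂ → ℂ) : ℝ≥0∞ := ∫⁻ p, ENNReal.ofReal (energy p) * ‖u p‖ₑ ^ 2

/-- The constant 4 is a factor 2 from the kernel bound and a factor 2 from the Schur test; the
weight |p| is then dominated by E(p). -/
lemma lintegral_potIntegrand_le (hu : AEStronglyMeasurable u volume) :
    ∫⁻ q, ‖potIntegrand u q.1 q.2‖ₑ ∂(volume.prod volume) ≤ 4 * rieszConst * kinetic u := by
  calc _ ≤ ∫⁻ q : ℂ × ℂ, 2 * (‖u q.1‖ₑ * ‖u q.2‖ₑ * ENNReal.ofReal (‖q.1 - q.2‖⁻¹))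
        ∂(volume.prod volume) := lintegral_mono fun q => by
          rw [potIntegrand, enorm_mul, enorm_mul, RCLike.enorm_conj]
          have : ‖kernel q.1 q.2‖ₑ ≤ 2 * ENNReal.ofReal (‖q.1 - q.2‖⁻¹) := by
            rw [← ofReal_norm, ← ENNReal.ofReal_ofNat, ← ENNReal.ofReal_mul (by norm_num)]
            exact ENNReal.ofReal_le_ofReal (norm_kernel_le _ _)
          calc _ ≤ ‖u q.1‖ₑ * ‖u q.2‖ₑ * (2 * ENNReal.ofReal (‖q.1 - q.2‖⁻¹)) := by gcongr
            _ = _ := by ring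
    _ ≤ 2 * (2 * rieszConst * ∫⁻ p, ENNReal.ofReal ‖p‖ * ‖u p‖ₑ ^ 2) := by
        rw [lintegral_const_mul' _ _ (by norm_num)]
        gcongr
        exact lintegral_prod_inv_norm_sub_le hu.enorm
    _ ≤ 2 * (2 * rieszConst * kinetic u) := by
        unfold kinetic
        gcongr
        exact norm_le_energy _
    _ = _ := by ring

lemma integrable_potIntegrand (hu : AEStronglyMeasurable u volume) (h : kinetic u ≠ ⊤) :
    Integrable (fun q : ℂ × ℂ => potIntegrand u q.1 q.2) (volume.prod volume) := by
  refine ⟨aestronglyMeasurable_potIntegrand hu, (lintegral_potIntegrand_le hu).trans_lt ?_⟩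
  exact ENNReal.mul_lt_top (ENNReal.mul_lt_top (by simp) rieszConst_ne_top.lt_top) h.lt_top

/-- The contribution of the `k`-th partial wave to the potential energy density at radii
`(r, r')`. -/
def radialDensity (u : ℂ → ℂ) (k : ℤ) (x : ℝ × ℝ) : ℂ :=
  ((2 * radialKernel k x.1 x.2 / Real.sqrt (x.1 * x.2) : ℝ) : ℂ)
    * (circleCoeff u k x.1 * starRingEnd ℂ (circleCoeff u k x.2))

lemma ae_radialMeasure_prod {p : ℝ → Prop} (h : ∀ᵐ r ∂radialMeasure, p r) :
    ∀ᵐ x ∂(radialMeasure.prod radialMeasure), p x.1 ∧ p x.2 :=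
  (Measure.quasiMeasurePreserving_fst.ae h).and (Measure.quasiMeasurePreserving_snd.ae h)

lemma ae_radialMeasure_prod_ne :
    ∀ᵐ x ∂(radialMeasure.prod radialMeasure), x.1 ≠ x.2 := by
  have hm : MeasurableSet {x : ℝ × ℝ | x.1 = x.2} := measurableSet_eq_fun measurable_fst measurable_snd
  have h : (radialMeasure.prod radialMeasure) {x : ℝ × ℝ | x.1 = x.2} = 0 := by
    rw [Measure.measure_prod_null hm]
    refine Eventually.of_forall fun r => radialMeasure_ac ?_
    have : Prod.mk r ⁻¹' {x : ℝ × ℝ | x.1 = x.2} = {r} := by ext; simp [eq_comm]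
    rw [this, halfLine]
    simp
  exact measure_eq_zero_iff_ae_notMem.1 h

lemma ae_hasSum_radialDensity (hu : MemLp u 2 volume) :
    ∀ᵐ x ∂(radialMeasure.prod radialMeasure), HasSum (fun k => radialDensity u k x)
      (∫ y, potIntegrand u (polarMap₂ (x, y)).1 (polarMap₂ (x, y)).2
        ∂(angleMeasure.prod angleMeasure)) := by
  filter_upwards [ae_radialMeasure_prod ae_radialMeasure_pos, ae_radialMeasure_prod_ne,
    ae_radialMeasure_prod (ae_memLp_circle hu)] with x h1 h2 h3
  exact hasSum_angleCoeff_kernel h1.1 h1.2 h2 (h3.1.integrable (by norm_num))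
    (h3.2.integrable (by norm_num))

lemma integrable_potIntegrand_polarMap₂ (hu : AEStronglyMeasurable u volume)
    (h : kinetic u ≠ ⊤) :
    Integrable (fun x => potIntegrand u (polarMap₂ x).1 (polarMap₂ x).2)
      ((radialMeasure.prod radialMeasure).prod (angleMeasure.prod angleMeasure)) :=
  (measurePreserving_polarMap₂.integrable_comp (aestronglyMeasurable_potIntegrand hu)).2
    (integrable_potIntegrand hu h)

lemma integral_potIntegrand_eq (hu : MemLp u 2 volume) (h : kinetic u ≠ ⊤) :
    ∫ p, ∫ p', potIntegrand u p p'
      = ∫ x, ∑' k, radialDensity u k x ∂(radialMeasure.prod radialMeasure) := by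
  rw [← integral_prod _ (integrable_potIntegrand hu.1 h), ← measurePreserving_polarMap₂.map_eq,
    integral_map measurePreserving_polarMap₂.aemeasurable (by
      rw [measurePreserving_polarMap₂.map_eq]
      exact aestronglyMeasurable_potIntegrand hu.1),
    integral_prod _ (integrable_potIntegrand_polarMap₂ hu.1 h)]
  exact integral_congr_ae ((ae_hasSum_radialDensity hu).mono fun x hx => hx.tsum_eq.symm)

lemma circleCoeff_partialWave_radialPart (j k : ℤ) {r : ℝ} (hr : 0 < r) :
    circleCoeff (partialWave (radialPart u) k) j r = if k = j then circleCoeff u k r else 0 := by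
  have h : (fun θ => partialWave (radialPart u) k (polarMap (r, θ))) =ᵐ[angleMeasure] fun θ : ℝ =>
      ((1 / Real.sqrt (2 * Real.pi) : ℝ) : ℂ) * ((1 / Real.sqrt r : ℝ) : ℂ) * radialPart u k r
        * Complex.exp (Complex.I * k * θ) := by
    filter_upwards [ae_angleMeasure_mem] with θ hθ
    rw [partialWave_polarMap hr hθ]
  rw [circleCoeff, angleCoeff_congr h, angleCoeff_exp]
  split_ifs
  · have hs0 : (Real.sqrt (2 * Real.pi) : ℂ) ≠ 0 := by
      exact_mod_cast (by positivity : Real.sqrt (2 * Real.pi) ≠ 0)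
    have h3 : (Real.sqrt r : ℂ) ≠ 0 := by
      exact_mod_cast (by positivity : Real.sqrt r ≠ 0)
    rw [radialPart]
    push_cast
    field_simp
  · rfl

lemma kinetic_partialWave (hu : AEStronglyMeasurable u volume) (k : ℤ) :
    kinetic (partialWave (radialPart u) k)
      = ∫⁻ r, ENNReal.ofReal (e r) * ‖radialPart u k r‖ₑ ^ 2 ∂halfLine :=
  lintegral_partialWave_sq (aestronglyMeasurable_radialPart hu k) (g := fun r => ENNReal.ofReal (e r))
    (by unfold e; fun_prop)

lemma tsum_kinetic_partialWave (hu : MemLp u 2 volume) :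
    ∑' k, kinetic (partialWave (radialPart u) k) = kinetic u := by
  simp only [kinetic_partialWave hu.1]
  exact tsum_lintegral_radialPart hu (g := fun r => ENNReal.ofReal (e r)) (by unfold e; fun_prop)

lemma kinetic_partialWave_ne_top (hu : MemLp u 2 volume) (h : kinetic u ≠ ⊤) (k : ℤ) :
    kinetic (partialWave (radialPart u) k) ≠ ⊤ :=
  ne_top_of_le_ne_top (tsum_kinetic_partialWave hu ▸ h) (ENNReal.le_tsum k)

/-- The angular expansion applied to a single partial wave of u has one surviving term.
Integrability and norm bounds for the radial densities thereby come from the planar estimates. -/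
lemma radialDensity_ae_eq (hu : MemLp u 2 volume) (k : ℤ) :
    radialDensity u k =ᵐ[radialMeasure.prod radialMeasure] fun x =>
      ∫ y, potIntegrand (partialWave (radialPart u) k) (polarMap₂ (x, y)).1 (polarMap₂ (x, y)).2
        ∂(angleMeasure.prod angleMeasure) := by
  filter_upwards [ae_hasSum_radialDensity (memLp_partialWave (memLp_radialPart hu k)),
    ae_radialMeasure_prod ae_radialMeasure_pos] with x hx h1
  -- The sum over j has only the term j = k, and uniqueness of sums identifies that term with the
  -- angular integral.
  refine (hasSum_single k fun j hj => ?_).unique hx |>.symm ▸ ?_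
  · rw [radialDensity, circleCoeff_partialWave_radialPart j k h1.1, if_neg hj.symm]
    simp
  · simp only [radialDensity, circleCoeff_partialWave_radialPart k k h1.1,
      circleCoeff_partialWave_radialPart k k h1.2, if_true]

lemma integrable_radialDensity (hu : MemLp u 2 volume) (h : kinetic u ≠ ⊤) (k : ℤ) :
    Integrable (radialDensity u k) (radialMeasure.prod radialMeasure) :=
  (integrable_potIntegrand_polarMap₂ (memLp_partialWave (memLp_radialPart hu k)).1
    (kinetic_partialWave_ne_top hu h k)).integral_prod_left.congr (radialDensity_ae_eq hu k).symm

lemma lintegral_radialDensity_le (hu : MemLp u 2 volume) (k : ℤ) :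
    ∫⁻ x, ‖radialDensity u k x‖ₑ ∂(radialMeasure.prod radialMeasure)
      ≤ 4 * rieszConst * kinetic (partialWave (radialPart u) k) := by
  have hm := (memLp_partialWave (memLp_radialPart hu k)).1
  refine le_trans ?_ (lintegral_potIntegrand_le hm)
  have hpm := aestronglyMeasurable_potIntegrand hm
  have hpm' : AEMeasurable (fun x => ‖potIntegrand (partialWave (radialPart u) k)
      (polarMap₂ x).1 (polarMap₂ x).2‖ₑ)
      ((radialMeasure.prod radialMeasure).prod (angleMeasure.prod angleMeasure)) :=
    (hpm.comp_quasiMeasurePreserving measurePreserving_polarMap₂.quasiMeasurePreserving).enorm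
  rw [← measurePreserving_polarMap₂.map_eq, lintegral_map' (by
      rw [measurePreserving_polarMap₂.map_eq]
      exact hpm.enorm) measurePreserving_polarMap₂.aemeasurable,
    lintegral_prod _ hpm']
  refine lintegral_mono_ae ((radialDensity_ae_eq hu k).mono fun x hx => ?_)
  rw [hx]
  exact enorm_integral_le_lintegral_enorm _

/-- The L¹ norm of the k-th density is at most a constant independent of k times the kinetic energy
of the k-th wave, and these energies sum to the finite `kinetic u`. -/
lemma hasSum_integral_radialDensity (hu : MemLp u 2 volume) (h : kinetic u ≠ ⊤) :
    HasSum (fun k => ∫ x, radialDensity u k x ∂(radialMeasure.prod radialMeasure))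
      (∫ p, ∫ p', potIntegrand u p p') := by
  rw [integral_potIntegrand_eq hu h]
  refine hasSum_integral_of_summable_integral_norm (integrable_radialDensity hu h) ?_
  have hsum : ∑' k, ∫⁻ x, ‖radialDensity u k x‖ₑ ∂(radialMeasure.prod radialMeasure) ≠ ⊤ := by
    refine ne_top_of_le_ne_top ?_ (ENNReal.tsum_le_tsum (lintegral_radialDensity_le hu))
    rw [ENNReal.tsum_mul_left, tsum_kinetic_partialWave hu]
    exact ENNReal.mul_ne_top (ENNReal.mul_ne_top (by simp) rieszConst_ne_top) h
  refine (ENNReal.summable_toReal hsum).congr fun k => ?_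
  rw [integral_norm_eq_lintegral_enorm (integrable_radialDensity hu h k).1]

end

/-! ### Return to the measure dr, the kinetic term and the weighted space -/

section

lemma radialMeasure_prod : radialMeasure.prod radialMeasure
    = (halfLine.prod halfLine).withDensity
      fun x => ENNReal.ofReal x.1 * ENNReal.ofReal x.2 := by
  rw [radialMeasure, prod_withDensity (by fun_prop) (by fun_prop)]

variable {u : ℂ → ℂ}

/-- The Jacobian r r' divided by the √(r r') of the density leaves √r √r', which turns the circle
coefficients into `radialPart`. -/
lemma smul_radialDensity_ae_eq (u : ℂ → ℂ) (k : ℤ) :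
    (fun x : ℝ × ℝ => (ENNReal.ofReal x.1 * ENNReal.ofReal x.2).toReal • radialDensity u k x)
      =ᵐ[halfLine.prod halfLine] fun x => 2 * radialPotIntegrand k (radialPart u k) x.1 x.2 := by
  filter_upwards [Measure.quasiMeasurePreserving_fst.ae ae_halfLine_pos,
    Measure.quasiMeasurePreserving_snd.ae ae_halfLine_pos] with x h1 h2
  have hs1 : (Real.sqrt x.1 : ℂ) * Real.sqrt x.1 = x.1 := by
    exact_mod_cast Real.mul_self_sqrt h1.le
  have hs2 : (Real.sqrt x.2 : ℂ) * Real.sqrt x.2 = x.2 := by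
    exact_mod_cast Real.mul_self_sqrt h2.le
  have h01 : (Real.sqrt x.1 : ℂ) ≠ 0 := by exact_mod_cast (Real.sqrt_pos.2 h1).ne'
  have h02 : (Real.sqrt x.2 : ℂ) ≠ 0 := by exact_mod_cast (Real.sqrt_pos.2 h2).ne'
  rw [ENNReal.toReal_mul, ENNReal.toReal_ofReal h1.le, ENNReal.toReal_ofReal h2.le,
    Complex.real_smul, radialDensity, radialPotIntegrand, radialPart, radialPart,
    Real.sqrt_mul h1.le, map_mul, Complex.conj_ofReal]
  push_cast
  rw [← hs1, ← hs2]
  field_simp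

lemma integrable_radialPotIntegrand_radialPart (hu : MemLp u 2 volume) (h : kinetic u ≠ ⊤)
    (k : ℤ) :
    Integrable (fun q : ℝ × ℝ => radialPotIntegrand k (radialPart u k) q.1 q.2)
      (halfLine.prod halfLine) := by
  have h1 := integrable_radialDensity hu h k
  rw [radialMeasure_prod, integrable_withDensity_iff_integrable_smul' (by fun_prop)
    (Eventually.of_forall fun x => ENNReal.mul_lt_top ENNReal.ofReal_lt_top ENNReal.ofReal_lt_top),
    integrable_congr (smul_radialDensity_ae_eq u k)] at h1
  simpa using h1.const_mul (1 / 2)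

lemma integral_radialDensity (k : ℤ) :
    ∫ x, radialDensity u k x ∂(radialMeasure.prod radialMeasure)
      = 2 * ∫ q, radialPotIntegrand k (radialPart u k) q.1 q.2 ∂(halfLine.prod halfLine) := by
  rw [radialMeasure_prod, integral_withDensity_eq_integral_toReal_smul (by fun_prop)
    (Eventually.of_forall fun x => ENNReal.mul_lt_top ENNReal.ofReal_lt_top ENNReal.ofReal_lt_top),
    integral_congr_ae (smul_radialDensity_ae_eq u k), integral_const_mul]

lemma measurable_weight :
    Measurable fun p : ℂ => ENNReal.ofReal (Real.sqrt (1 + ‖p‖ ^ 2)) := by fun_prop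

lemma volume_ac_weightedMeasure : (volume : Measure ℂ) ≪ weightedMeasure :=
  withDensity_absolutelyContinuous' measurable_weight.aemeasurable
    (Eventually.of_forall fun p => by
      have : 0 < Real.sqrt (1 + ‖p‖ ^ 2) := by positivity
      simpa using this)

lemma kinetic_ne_top (hu : MemLp u 2 weightedMeasure) : kinetic u ≠ ⊤ := by
  have h : ∫⁻ p, ‖u p‖ₑ ^ 2 ∂weightedMeasure ≠ ⊤ := by
    rw [← eLpNorm_two_sq]
    exact ENNReal.pow_ne_top hu.2.ne
  rw [weightedMeasure, lintegral_withDensity_eq_lintegral_mul_non_measurable _ measurable_weight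
    (by simp)] at h
  simpa only [kinetic, energy, add_comm, Pi.mul_apply] using! h

lemma memLp_volume (hu : MemLp u 2 weightedMeasure) : MemLp u 2 volume := by
  refine memLp_two_of_lintegral (hu.1.mono_ac volume_ac_weightedMeasure) ?_
  refine ne_top_of_le_ne_top (kinetic_ne_top hu) (lintegral_mono fun p => ?_)
  calc ‖u p‖ₑ ^ 2 = ENNReal.ofReal 1 * ‖u p‖ₑ ^ 2 := by simp
    _ ≤ _ := by gcongr; exact one_le_energy p

section

variable {α : Type*} [MeasurableSpace α] {μ : Measure α} {g : α → ℝ} {f : α → ℂ}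

lemma enorm_mul_norm_sq {g : ℝ} (hg : 0 ≤ g) (z : ℂ) :
    ‖g * ‖z‖ ^ 2‖ₑ = ENNReal.ofReal g * ‖z‖ₑ ^ 2 := by
  rw [← ofReal_norm, ← ofReal_norm, Real.norm_of_nonneg (by positivity),
    ENNReal.ofReal_mul hg, ENNReal.ofReal_pow (norm_nonneg _)]

lemma integrable_mul_norm_sq (hg : Measurable g) (hg0 : ∀ x, 0 ≤ g x)
    (hf : AEStronglyMeasurable f μ) (h : ∫⁻ x, ENNReal.ofReal (g x) * ‖f x‖ₑ ^ 2 ∂μ ≠ ⊤) :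
    Integrable (fun x => g x * ‖f x‖ ^ 2) μ := by
  refine ⟨hg.aestronglyMeasurable.mul (hf.norm.pow 2), ?_⟩
  simp only [hasFiniteIntegral_iff_enorm, enorm_mul_norm_sq (hg0 _)]
  exact h.lt_top

lemma integral_mul_norm_sq (hg : Measurable g) (hg0 : ∀ x, 0 ≤ g x)
    (hf : AEStronglyMeasurable f μ) :
    ∫ x, g x * ‖f x‖ ^ 2 ∂μ = (∫⁻ x, ENNReal.ofReal (g x) * ‖f x‖ₑ ^ 2 ∂μ).toReal := by
  rw [← integral_congr_ae (f := fun x => ‖g x * ‖f x‖ ^ 2‖) (Eventually.of_forall fun x =>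
    Real.norm_of_nonneg (mul_nonneg (hg0 x) (by positivity))),
    integral_norm_eq_lintegral_enorm (f := fun x => g x * ‖f x‖ ^ 2)
      (hg.aestronglyMeasurable.mul (hf.norm.pow 2))]
  simp only [enorm_mul_norm_sq (hg0 _)]

end

lemma measurable_e : Measurable e := by unfold e; fun_prop

lemma e_nonneg (r : ℝ) : 0 ≤ e r := Real.sqrt_nonneg _

/-- Parseval with the radial weight e(r), passed from extended nonnegative reals to reals by
finiteness of the kinetic energy. -/
lemma hasSum_integral_radialPart_sq (hu : MemLp u 2 volume) (h : kinetic u ≠ ⊤) :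
    HasSum (fun k => ∫ r, e r * ‖radialPart u k r‖ ^ 2 ∂halfLine)
      (∫ p, energy p * ‖u p‖ ^ 2) := by
  have h1 := tsum_kinetic_partialWave hu
  rw [integral_mul_norm_sq measurable_energy (fun p => Real.sqrt_nonneg _) hu.1]
  change HasSum _ (kinetic u).toReal
  simp only [integral_mul_norm_sq measurable_e e_nonneg
    (aestronglyMeasurable_radialPart hu.1 _), ← kinetic_partialWave hu.1]
  rw [← h1, ENNReal.tsum_toReal_eq (kinetic_partialWave_ne_top hu h)]
  exact (ENNReal.summable_toReal (h1 ▸ h)).hasSum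

lemma radialPotIntegrand_ae_eq {k : ℤ} {a b : ℝ → ℂ} (h : a =ᵐ[halfLine] b) :
    (fun q : ℝ × ℝ => radialPotIntegrand k a q.1 q.2) =ᵐ[halfLine.prod halfLine]
      fun q => radialPotIntegrand k b q.1 q.2 := by
  filter_upwards [Measure.quasiMeasurePreserving_fst.ae h,
    Measure.quasiMeasurePreserving_snd.ae h] with q h1 h2
  rw [radialPotIntegrand, radialPotIntegrand, h1, h2]

lemma radialForm_eq {δ : ℝ} {k : ℤ} {a : ℝ → ℂ}
    (ha : Integrable (fun q : ℝ × ℝ => radialPotIntegrand k a q.1 q.2)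
      (halfLine.prod halfLine)) :
    radialForm δ k a = ((∫ r, e r * ‖a r‖ ^ 2 ∂halfLine : ℝ) : ℂ)
      - ((δ / Real.pi : ℝ) : ℂ)
        * ∫ q, radialPotIntegrand k a q.1 q.2 ∂(halfLine.prod halfLine) := by
  rw [integral_prod _ ha]
  rfl

end

end BrownRavenhall

end

theorem mainTheorem2 (δ : ℝ) (hδ : 0 < δ) (u : ℂ → ℂ)
    (hu : MemLp u 2 BrownRavenhall.weightedMeasure) :
    -- the integrals in `⟨u, b u⟩` converge absolutely
    Integrable (fun p : ℂ => BrownRavenhall.energy p * ‖u p‖ ^ 2) volume ∧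
    Integrable (fun q : ℂ × ℂ => BrownRavenhall.potIntegrand u q.1 q.2)
      ((volume : Measure ℂ).prod volume) ∧
    -- `u` has a partial wave expansion
    (∃ a : ℤ → ℝ → ℂ, BrownRavenhall.IsPartialWaveExpansion u a) ∧
    ∀ a : ℤ → ℝ → ℂ, BrownRavenhall.IsPartialWaveExpansion u a →
      -- the integrals in `⟨a_k, b_k a_k⟩` converge absolutely
      (∀ k : ℤ,
        IntegrableOn (fun r : ℝ => BrownRavenhall.e r * ‖a k r‖ ^ 2) (Ioi 0) volume ∧
        Integrable (fun q : ℝ × ℝ => BrownRavenhall.radialPotIntegrand k (a k) q.1 q.2)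
          (((volume : Measure ℝ).restrict (Ioi 0)).prod (volume.restrict (Ioi 0)))) ∧
      -- and the form decomposes
      HasSum (fun k : ℤ => BrownRavenhall.radialForm δ k (a k)) (BrownRavenhall.form δ u) := by
  open BrownRavenhall in
  have hv := memLp_volume hu
  have hk := kinetic_ne_top hu
  refine ⟨integrable_mul_norm_sq measurable_energy (fun p => Real.sqrt_nonneg _) hv.1 hk,
    integrable_potIntegrand hv.1 hk, ⟨_, isPartialWaveExpansion_radialPart hv⟩, fun a ha => ?_⟩
  -- By uniqueness every integral involving a k can be computed with `radialPart u k`.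
  have hae := ha.ae_eq_radialPart hv
  have hkin : ∀ k, (fun r => e r * ‖a k r‖ ^ 2) =ᵐ[halfLine]
      fun r => e r * ‖radialPart u k r‖ ^ 2 := fun k =>
    (hae k).mono fun r hr => by beta_reduce; rw [hr]
  have hpot : ∀ k, Integrable (fun q : ℝ × ℝ => radialPotIntegrand k (a k) q.1 q.2)
      (halfLine.prod halfLine) := fun k =>
    (integrable_radialPotIntegrand_radialPart hv hk k).congr
      (radialPotIntegrand_ae_eq (hae k)).symm
  refine ⟨fun k => ⟨?_, hpot k⟩, ?_⟩
  · refine Integrable.congr ?_ (hkin k).symm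
    refine integrable_mul_norm_sq measurable_e e_nonneg (aestronglyMeasurable_radialPart hv.1 k) ?_
    exact kinetic_partialWave hv.1 k ▸ kinetic_partialWave_ne_top hv hk k
  · have h1 := Complex.hasSum_ofReal.2 (hasSum_integral_radialPart_sq hv hk)
    -- The factor 2 in `integral_radialDensity` turns the planar constant δ/(2π) into the radial
    -- constant δ/π.
    have h2 := (hasSum_integral_radialDensity hv hk).mul_left ((δ / (2 * Real.pi) : ℝ) : ℂ)
    convert! h1.sub h2 using 1
    funext k
    rw [radialForm_eq (hpot k), integral_congr_ae (hkin k),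
      integral_congr_ae (radialPotIntegrand_ae_eq (hae k)), integral_radialDensity, ← mul_assoc]
    congr 2
    push_cast
    have : (Real.pi : ℂ) ≠ 0 := by exact_mod_cast Real.pi_ne_zero
    field_simp
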